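/- **Setting.** Circles are oriented generalized circles (circles and lines) in the Riemann sphere, with signed curvature: positive if the interior is the bounded disc, negative if the interior is the complement of the closed bounded disc, and $0$ for a line (whose interior is a half-plane). A *cubic configuration* consists of eight circles with pairwise disjoint interiors, indexed by the vertices of a cube, where two circles are tangent if the vertices are adjacent and disjoint otherwise, together with six dual circles with pairwise disjoint interiors, indexed by the faces, where two dual circles are tangent if the faces share an edge and disjoint otherwise; a circle and a dual circle are orthogonal if the vertex lies on the face, and disjoint otherwise. The *Apollonian group* is generated by the reflections in the six dual circles. The images of the eight circles under an element of this group form an *octuple*, and the *cubic packing* $\mathcal A$ is the set of all circles in all octuples. The packing is *primitive* if all its curvatures are integers and their greatest common divisor is $1$. It is of *type $(0,2,3)$* if the residues modulo $4$ of its curvatures are exactly $0,2,3$. Let $\left(\frac{\cdot}{\cdot}\right)$ be the Kronecker symbol: for $n\ne 0$ the symbol $\left(\frac{m}{n}\right)$ is multiplicative in $n$, is the Legendre symbol if $n$ is an odd prime, $\left(\frac m2\right)$ is $1$, $-1$, $0$ according to whether $m\equiv\pm1 \bmod 8$, $m\equiv\pm3\bmod 8$, or $m$ is even, and $\left(\frac{m}{-1}\right)$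 is $1$ for $m\ge 0$ and $-1$ for $m<0$. For a circle $\mathcal C\in\mathcal A$ of curvature $a\neq 0$ in an octuple in which its three neighbours on the cube have curvatures $b,d,e$, put $$Q(x,y)=(a+b)x^2-(a+b+d-e)xy+(a+d)y^2 .$$ Choose an integer $\rho$ coprime to $a$ with $\rho=Q(x,y)$ for some coprime integers $x,y$, $y\ge 0$, and, for a packing of type $(0,2,3)$, set $$\chi_2(\mathcal C)=\begin{cases}\left(\frac{\rho}{a}\right) & a\equiv 3 \bmod 4,\\[2pt] -\left(\frac{-\rho}{a}\right) & a\equiv 0\bmod 4,\\[2pt] -\left(\frac{\rho}{a/2}\right) & a\equiv 2\bmod 4.\end{cases}$$ **Proposition.** Let $\mathcal A$ be a primitive cubic packing of type $(0,2,3)$ whose circles are coloured blue and red so that tangent circles have different colours. 1. Every circle $\mathcal C\in\mathcal A$ has nonzero curvature, a number $\rho$ as above exists for it, and $\chi_2(\mathcal C)$ does not depend on the choice of the octuple containing $\mathcal C$ or of $\rho$. 2. There is $\varepsilon\in\{1,-1\}$ such that $\chi_2(\mathcal C)=\varepsilon$ for all blue circles and $\chi_2(\mathcal C)=-\varepsilon$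 for all red circles $\mathcal C\in\mathcal A$. 3. If $\chi_2(\mathcal C)=1$ for all blue circles $\mathcal C\in\mathcal A$, then no blue circle has curvature $n^2$ with $n\in\mathbb Z$, no blue circle has curvature $2n^2$ with $n$ an odd integer, and no red circle has curvature $8n^2$ with $n\in\mathbb Z$. -/

import Mathlib

/-- An oriented generalized circle (circle or line) of the complex plane, in inversive
coordinates: `curv` is the signed curvature, `cocurv` the cocurvature (the curvature of the image
under reflection in the unit circle), and `(h₁, h₂)` is the curvature times the centre
(for a line: the unit normal vector pointing into the interior half-plane). -/
@[ext]
structure GenCircle where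
  cocurv : ℝ
  curv : ℝ
  h₁ : ℝ
  h₂ : ℝ
  quad_eq : h₁ ^ 2 + h₂ ^ 2 - curv * cocurv = 1

namespace GenCircle

/-- For a circle of curvature `b ≠ 0` and centre `p` this is `b * (|z - p| ^ 2 - 1 / b ^ 2)`. -/
def eqn (C : GenCircle) (z : ℂ) : ℝ :=
  C.curv * Complex.normSq z - 2 * (C.h₁ * z.re + C.h₂ * z.im) + C.cocurv

/-- The points of the generalized circle on the Riemann sphere; lines pass through `∞`. -/
def carrier (C : GenCircle) : Set (OnePoint ℂ) :=
  {p | (∃ z : ℂ, p = (z : OnePoint ℂ) ∧ C.eqn z = 0) ∨ (p = OnePoint.infty ∧ C.curv = 0)}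

/-- The finite points of the interior: the bounded disc if `0 < curv`, the complement of the
closed bounded disc if `curv < 0`, and an open half-plane if `curv = 0`. -/
def interior (C : GenCircle) : Set ℂ :=
  {z | C.eqn z < 0}

/-- Two generalized circles are tangent if they meet in exactly one point of the sphere. -/
def Tangent (C D : GenCircle) : Prop :=
  ∃ p : OnePoint ℂ, C.carrier ∩ D.carrier = {p}

/-- The inner product of inversive coordinates. -/
noncomputable def inner (C D : GenCircle) : ℝ :=
  C.h₁ * D.h₁ + C.h₂ * D.h₂ - (C.curv * D.cocurv + C.cocurv * D.curv) / 2

/-- Two generalized circles are orthogonal if their inner product, which for intersecting circles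
is the dot product of the unit normals at an intersection point, vanishes. -/
def Orthogonal (C D : GenCircle) : Prop :=
  C.inner D = 0

/-- The image of the oriented circle `C` under reflection (inversion) in `M`. -/
noncomputable def reflect (M C : GenCircle) : GenCircle where
  cocurv := C.cocurv - 2 * C.inner M * M.cocurv
  curv := C.curv - 2 * C.inner M * M.curv
  h₁ := C.h₁ - 2 * C.inner M * M.h₁
  h₂ := C.h₂ - 2 * C.inner M * M.h₂
  quad_eq := by
    have h := C.quad_eq
    have hM := M.quad_eq
    simp only [inner]
    linear_combination h + 4 * (C.h₁ * M.h₁ + C.h₂ * M.h₂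
      - (C.curv * M.cocurv + C.cocurv * M.curv) / 2) ^ 2 * hM

theorem reflect_involutive (M : GenCircle) : Function.Involutive (reflect M) := by
  intro C
  have hM := M.quad_eq
  have key : (reflect M C).inner M = - C.inner M := by
    simp only [reflect, inner]
    linear_combination (-2) * (C.h₁ * M.h₁ + C.h₂ * M.h₂
      - (C.curv * M.cocurv + C.cocurv * M.curv) / 2) * hM
  have e : ∀ x y z : ℝ, x - 2 * y * z - 2 * (-y) * z = x := by intros; ring
  have r : reflect M (reflect M C) = ⟨_, _, _, _, (reflect M (reflect M C)).quad_eq⟩ := rfl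
  rw [r]
  ext <;> simp only [reflect] <;> change _ - 2 * (reflect M C).inner M * _ = _ <;>
    rw [key] <;> simp only [e]

/-- Reflection in `M` as a permutation of the set of oriented generalized circles. -/
noncomputable def reflection (M : GenCircle) : Equiv.Perm GenCircle :=
  (reflect_involutive M).toPerm

end GenCircle

/-- The eight vertices of the cube. -/
abbrev CubeVertex : Type := Fin 3 → Bool

/-- The six faces of the cube: `(k, s)` is the face of all vertices `v` with `v k = s`. -/
abbrev CubeFace : Type := Fin 3 × Bool

/-- The neighbour of `v` in direction `k`. -/
def CubeVertex.flip (v : CubeVertex) (k : Fin 3) : CubeVertex :=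
  Function.update v k (!(v k))

/-- Adjacency in the graph of the cube. -/
def CubeVertex.Adj (v w : CubeVertex) : Prop :=
  ∃ k : Fin 3, w = v.flip k

/-- A cubic circle configuration: eight base circles with pairwise disjoint interiors whose
tangency graph is the cube, and the six dual circles, one for each face. -/
structure CubicConfiguration where
  base : CubeVertex → GenCircle
  dual : CubeFace → GenCircle
  base_interior : ∀ v w, v ≠ w → Disjoint (base v).interior (base w).interior
  base_tangent : ∀ v w, CubeVertex.Adj v w → (base v).Tangent (base w)
  base_disjoint : ∀ v w, v ≠ w → ¬ CubeVertex.Adj v w →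
    Disjoint (base v).carrier (base w).carrier
  dual_interior : ∀ F G, F ≠ G → Disjoint (dual F).interior (dual G).interior
  dual_tangent : ∀ F G : CubeFace, F.1 ≠ G.1 → (dual F).Tangent (dual G)
  dual_disjoint : ∀ F G : CubeFace, F ≠ G → F.1 = G.1 →
    Disjoint (dual F).carrier (dual G).carrier
  incident_orthogonal : ∀ (v : CubeVertex) (F : CubeFace), v F.1 = F.2 →
    (base v).Orthogonal (dual F)
  nonincident_disjoint : ∀ (v : CubeVertex) (F : CubeFace), v F.1 ≠ F.2 →
    Disjoint (base v).carrier (dual F).carrier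

namespace CubicConfiguration

/-- The cubic Apollonian group, generated by the reflections in the dual circles. -/
def apollonianGroup (B : CubicConfiguration) : Subgroup (Equiv.Perm GenCircle) :=
  Subgroup.closure (Set.range fun F : CubeFace => (B.dual F).reflection)

/-- The octuples of circles of the packing: the images of the base octuple. -/
def IsOctuple (B : CubicConfiguration) (o : CubeVertex → GenCircle) : Prop :=
  ∃ g ∈ B.apollonianGroup, ∀ v, o v = g (B.base v)

/-- The cubic packing generated by `B`. -/
def packing (B : CubicConfiguration) : Set GenCircle :=
  {C | ∃ o, B.IsOctuple o ∧ ∃ v, C = o v}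

/-- All curvatures in the packing are integers. -/
def Integral (B : CubicConfiguration) : Prop :=
  ∀ C ∈ B.packing, ∃ n : ℤ, C.curv = n

/-- The packing is integral, and the greatest common divisor of all its curvatures is `1`. -/
def Primitive (B : CubicConfiguration) : Prop :=
  B.Integral ∧
    ∀ d : ℤ, (∀ C ∈ B.packing, ∃ n : ℤ, C.curv = ((d * n : ℤ) : ℝ)) → IsUnit d

/-- Type `(0,2,3)`: the curvatures in the packing represent exactly the residue classes
`0`, `2`, `3` modulo `4`. -/
def IsType023 (B : CubicConfiguration) : Prop :=
  {r : ZMod 4 | ∃ C ∈ B.packing, ∃ n : ℤ, C.curv = n ∧ (n : ZMod 4) = r} = {0, 2, 3}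

end CubicConfiguration

/-- The Kronecker symbol `(a / b)`, for `b ≠ 0`: the product of the factor at `-1`, the factor
`(a / 2)` to the power of the exponent of `2` in `b`, and the Jacobi symbol at the odd part. -/
def kroneckerSymbol (a b : ℤ) : ℤ :=
  (if b < 0 ∧ a < 0 then -1 else 1) * ZMod.χ₈ (a : ZMod 8) ^ padicValNat 2 b.natAbs *
    jacobiSym a (b.natAbs / 2 ^ padicValNat 2 b.natAbs)

/-- The quadratic form attached to a circle of curvature `a` and its three neighbours, of
curvatures `b`, `d`, `e`, in an octuple. -/
def cubicForm (a b d e : ℝ) (x y : ℤ) : ℝ :=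
  (a + b) * x ^ 2 - (a + b + d - e) * x * y + (a + d) * y ^ 2

/-- The expression that defines `χ₂` of a circle of curvature `a` in a packing of type `(0,2,3)`
by means of `ρ`. (The value for `a ≡ 1` modulo `4` is irrelevant.) -/
def chi2Value (a ρ : ℤ) : ℤ :=
  if a % 4 = 3 then kroneckerSymbol ρ a
  else if a % 4 = 0 then - kroneckerSymbol (-ρ) a
  else if a % 4 = 2 then - kroneckerSymbol ρ (a / 2)
  else 0

namespace CubicConfiguration

/-- `ρ` is primitively represented by the quadratic form `Q` of some octuple of the packing that
contains the circle `C`. (Permuting the three neighbours does not change the set of primitively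
represented numbers.) -/
def Represents (B : CubicConfiguration) (C : GenCircle) (ρ : ℤ) : Prop :=
  ∃ o, B.IsOctuple o ∧ ∃ v : CubeVertex, C = o v ∧
    ∃ x y : ℤ, 0 ≤ y ∧ IsCoprime x y ∧
      (ρ : ℝ) = cubicForm C.curv (o (v.flip 0)).curv (o (v.flip 1)).curv (o (v.flip 2)).curv x y

/-- `(a, ρ)` is a pair from which `χ₂(C)` may be computed: `a` is the curvature of `C`, and `ρ` is
an integer coprime to `a` represented by `Q`. -/
def Admissible (B : CubicConfiguration) (C : GenCircle) (a ρ : ℤ) : Prop :=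
  C.curv = a ∧ a ≠ 0 ∧ IsCoprime ρ a ∧ B.Represents C ρ

open Classical in
/-- The invariant `χ₂(C)` of a circle in a packing of type `(0,2,3)`, computed from any
admissible pair. -/
noncomputable def chi2 (B : CubicConfiguration) (C : GenCircle) : ℤ :=
  if h : ∃ p : ℤ × ℤ, B.Admissible C p.1 p.2 then
    chi2Value (Classical.choose h).1 (Classical.choose h).2
  else 0

end CubicConfiguration

/-- The two colours. -/
inductive Colour where
  | blue : Colour
  | red : Colour

/-- `col` restricts to a two-colouring of the circles of the packing: tangent circles have
different colours. -/
def CubicConfiguration.IsTwoColouring (B : CubicConfiguration) (col : GenCircle → Colour) : Prop :=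
  ∀ C ∈ B.packing, ∀ D ∈ B.packing, C.Tangent D → col C ≠ col D

/-!
Write every oriented circle as a vector of norm `1` in the Lorentz space of inversive coordinates,
so that tangent circles with disjoint interiors have inner product `-1`. The tangencies of the six
dual circles determine their Gram matrix, and a circle of the configuration is then determined up
to sign by its three orthogonal dual circles. Hence the base octuple is an affine cube
`P ± W₀ ± W₁ ± W₂` with `P`, `W₀`, `W₁`, `W₂` orthogonal of norms `-2, 1, 1, 1`
(`CubicConfiguration.exists_base_frame`). Reflections preserve this shape and the time orientation
of `P`, and the reflections in the dual circles preserve the lattice generated by the octuple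
(`CubicConfiguration.exists_octuple_frame`).

For a circle `C` with neighbours `B₀, B₁, B₂`, the sublattice orthogonal to `C` has the basis of null
vectors `C + Bₖ`. Its primitive null vectors are, up to sign, parametrized by coprime pairs `(x, y)`,
and their curvatures are the values of the quadratic form of `C`. The lattice does not depend on the
octuple, so neither do the represented numbers (`CubicConfiguration.Represents.exists_eq`). Since the
curvature functional is the inner product with a null vector, the form is
`p x² - 2βxy + q y²` with `pq = β² + 2a²`, where `a` is the curvature of `C` and `p = a + b` for a
neighbour of curvature `b`.

The arithmetic core is `AdjacentForms.chi2Value_mul`: the values of `χ₂` at two adjacent circles, not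
both of even curvature, have product `-1`. If `s` is the common factor of `a`, `p` and `β`, then
`a = s a₁`, `b = s b₁`, `p = s² p₁`, and the symbols of represented numbers are `(q / s)(p₁ / a₁)` and
`(q / s)(p₁ / b₁)` up to `2`-adic factors. As `a₁ + b₁ = s p₁`, quadratic reciprocity evaluates
`(p₁ / a₁ b₁)`, using that `-2` is a square modulo the odd part of `p₁`. Independence of the chosen
number follows, because the value at a neighbour stays fixed. Along an edge with two even curvatures
one goes around a face instead.

Thus `χ₂` and the colour both change sign along every edge of an octuple, and since neighbouring
octuples share a face, their product is constant. An admissible number is `3` modulo `8` if `4`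
divides the curvature, so curvatures `n²`, `2n²` with `n` odd, and `8n²` have a value of `χ₂` that
depends on their shape only, and this gives the obstructions.
-/

open NumberTheorySymbols

/-! ### Tangency and inversive coordinates -/

namespace GenCircle

theorem inner_comm (C D : GenCircle) : C.inner D = D.inner C := by
  simp only [inner]; ring

theorem interior_nonempty (C : GenCircle) : C.interior.Nonempty := by
  have h := C.quad_eq
  rcases lt_trichotomy C.curv 0 with hk | hk | hk
  · refine ⟨⟨C.h₁ / C.curv + 2 / C.curv, C.h₂ / C.curv⟩, ?_⟩
    have : C.eqn ⟨C.h₁ / C.curv + 2 / C.curv, C.h₂ / C.curv⟩ = 3 / C.curv := by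
      simp only [eqn, Complex.normSq_apply]
      field_simp [hk.ne]
      linear_combination -h
    simp only [interior, Set.mem_ofPred_eq, this]
    exact div_neg_of_pos_of_neg (by norm_num) hk
  · refine ⟨⟨(C.cocurv + 1) / 2 * C.h₁, (C.cocurv + 1) / 2 * C.h₂⟩, ?_⟩
    rw [hk] at h
    have : C.eqn ⟨(C.cocurv + 1) / 2 * C.h₁, (C.cocurv + 1) / 2 * C.h₂⟩ = -1 := by
      simp only [eqn, hk]
      linear_combination -(C.cocurv + 1) * h
    simp only [interior, Set.mem_ofPred_eq, this]
    norm_num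
  · refine ⟨⟨C.h₁ / C.curv, C.h₂ / C.curv⟩, ?_⟩
    have : C.eqn ⟨C.h₁ / C.curv, C.h₂ / C.curv⟩ = -1 / C.curv := by
      simp only [eqn, Complex.normSq_apply]
      field_simp [hk.ne']
      linear_combination -h
    simp only [interior, Set.mem_ofPred_eq, this]
    exact div_neg_of_neg_of_pos (by norm_num) hk

/-- Here `C - D` is a null vector, so `C.eqn - D.eqn` has a constant sign and one of the interiors
contains the other. -/
theorem inner_ne_one_of_disjoint_interior {C D : GenCircle}
    (h : Disjoint C.interior D.interior) : C.inner D ≠ 1 := by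
  intro h1
  have hC := C.quad_eq
  have hD := D.quad_eq
  simp only [inner] at h1
  have hn : (C.h₁ - D.h₁) ^ 2 + (C.h₂ - D.h₂) ^ 2
      = (C.curv - D.curv) * (C.cocurv - D.cocurv) := by
    linear_combination hC + hD - 2 * h1
  have key : ∀ z : ℂ, (C.curv - D.curv) * (C.eqn z - D.eqn z)
      = ((C.curv - D.curv) * z.re - (C.h₁ - D.h₁)) ^ 2
        + ((C.curv - D.curv) * z.im - (C.h₂ - D.h₂)) ^ 2 := by
    intro z
    simp only [eqn, Complex.normSq_apply]
    linear_combination -hn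
  have sub : (∀ z, C.eqn z ≤ D.eqn z) ∨ (∀ z, D.eqn z ≤ C.eqn z) := by
    rcases lt_trichotomy (C.curv - D.curv) 0 with hk | hk | hk
    · left
      intro z
      have : 0 ≤ (C.curv - D.curv) * (C.eqn z - D.eqn z) := by rw [key]; positivity
      nlinarith
    · rw [hk] at hn
      have e1 : C.h₁ - D.h₁ = 0 := by nlinarith [sq_nonneg (C.h₁ - D.h₁), sq_nonneg (C.h₂ - D.h₂)]
      have e2 : C.h₂ - D.h₂ = 0 := by nlinarith [sq_nonneg (C.h₁ - D.h₁), sq_nonneg (C.h₂ - D.h₂)]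
      have e : ∀ z, C.eqn z - D.eqn z = C.cocurv - D.cocurv := by
        intro z
        simp only [eqn]
        linear_combination Complex.normSq z * hk - 2 * z.re * e1 - 2 * z.im * e2
      rcases le_total C.cocurv D.cocurv with hc | hc
      · left; intro z; linarith [e z]
      · right; intro z; linarith [e z]
    · right
      intro z
      have : 0 ≤ (C.curv - D.curv) * (C.eqn z - D.eqn z) := by rw [key]; positivity
      nlinarith
  rcases sub with hs | hs
  · obtain ⟨z, hz⟩ := D.interior_nonempty
    exact Set.disjoint_left.1 h (lt_of_le_of_lt (hs z) hz) hz
  · obtain ⟨z, hz⟩ := C.interior_nonempty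
    exact Set.disjoint_left.1 h hz (lt_of_le_of_lt (hs z) hz)

theorem exists_forall_eqn_neg {C : GenCircle} (hC : C.curv < 0) :
    ∃ R : ℝ, ∀ x : ℝ, R ≤ x → C.eqn ⟨x, 0⟩ < 0 := by
  refine ⟨1 + (2 * |C.h₁| + |C.cocurv|) / (-C.curv), fun x hx => ?_⟩
  have hk : 0 < -C.curv := by linarith
  have h0 : 0 ≤ (2 * |C.h₁| + |C.cocurv|) / (-C.curv) := by positivity
  have h1 : 2 * |C.h₁| + |C.cocurv| < x * (-C.curv) := by
    rw [← div_lt_iff₀ hk]; linarith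
  have hx1 : 1 ≤ x := by linarith
  simp only [eqn, Complex.normSq_apply]
  have e1 : -C.h₁ * x ≤ |C.h₁| * x :=
    mul_le_mul_of_nonneg_right (neg_le_abs _) (by linarith)
  have e2 : C.cocurv ≤ |C.cocurv| * x := by nlinarith [le_abs_self C.cocurv, abs_nonneg C.cocurv]
  nlinarith

theorem curv_nonneg_of_disjoint_interior {C D : GenCircle}
    (h : Disjoint C.interior D.interior) (hC : C.curv < 0) : 0 ≤ D.curv := by
  by_contra! hD
  obtain ⟨R, hR⟩ := exists_forall_eqn_neg hC
  obtain ⟨S, hS⟩ := exists_forall_eqn_neg hD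
  exact Set.disjoint_left.1 h (hR (max R S) (le_max_left _ _)) (hS (max R S) (le_max_right _ _))

theorem coe_mem_carrier {C : GenCircle} {z : ℂ} :
    (z : OnePoint ℂ) ∈ C.carrier ↔ C.eqn z = 0 := by
  simp [carrier]

theorem infty_mem_carrier {C : GenCircle} :
    (OnePoint.infty : OnePoint ℂ) ∈ C.carrier ↔ C.curv = 0 := by
  simp [carrier]

/-- If two generalized circles meet in a finite point `z` at an angle, and `C` is not a line, then
they meet in a second finite point. -/
theorem exists_second_point {C D : GenCircle} {z : ℂ} (hC : C.eqn z = 0) (hD : D.eqn z = 0)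
    (hk : C.curv ≠ 0) (hI : C.inner D ^ 2 ≠ 1) :
    ∃ w : ℂ, w ≠ z ∧ C.eqn w = 0 ∧ D.eqn w = 0 := by
  obtain ⟨x, y⟩ := z
  have qC := C.quad_eq
  have qD := D.quad_eq
  simp only [eqn, Complex.normSq_apply] at hC hD
  -- unit normals `g`, `g'` at the point
  obtain ⟨g1, hg1⟩ : ∃ g, g = C.curv * x - C.h₁ := ⟨_, rfl⟩
  obtain ⟨g2, hg2⟩ : ∃ g, g = C.curv * y - C.h₂ := ⟨_, rfl⟩
  obtain ⟨f1, hf1⟩ : ∃ g, g = D.curv * x - D.h₁ := ⟨_, rfl⟩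
  obtain ⟨f2, hf2⟩ : ∃ g, g = D.curv * y - D.h₂ := ⟨_, rfl⟩
  have ng : g1 ^ 2 + g2 ^ 2 = 1 := by subst hg1 hg2; linear_combination C.curv * hC + qC
  have nf : f1 ^ 2 + f2 ^ 2 = 1 := by subst hf1 hf2; linear_combination D.curv * hD + qD
  have hin : C.inner D = g1 * f1 + g2 * f2 := by
    subst hg1 hg2 hf1 hf2
    simp only [inner]
    linear_combination (-1 / 2 * D.curv) * hC + (-1 / 2 * C.curv) * hD
  have hcr : g1 * f2 - g2 * f1 ≠ 0 := by
    intro h0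
    apply hI
    rw [hin]
    linear_combination (f1 ^ 2 + f2 ^ 2) * ng + nf - (g1 * f2 - g2 * f1) * h0
  -- the common chord is orthogonal to `w = k' g - k g'`
  obtain ⟨w1, hw1⟩ : ∃ w, w = D.curv * g1 - C.curv * f1 := ⟨_, rfl⟩
  obtain ⟨w2, hw2⟩ : ∃ w, w = D.curv * g2 - C.curv * f2 := ⟨_, rfl⟩
  have hgw : -g1 * w2 + g2 * w1 = C.curv * (g1 * f2 - g2 * f1) := by subst hw1 hw2; ring
  have hne : -g1 * w2 + g2 * w1 ≠ 0 := by rw [hgw]; exact mul_ne_zero hk hcr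
  have hW : w1 ^ 2 + w2 ^ 2 ≠ 0 := by
    intro h0
    have a1 : w1 = 0 := by nlinarith [sq_nonneg w1, sq_nonneg w2]
    have a2 : w2 = 0 := by nlinarith [sq_nonneg w1, sq_nonneg w2]
    apply hne; rw [a1, a2]; ring
  obtain ⟨s, hs⟩ : ∃ s, s = -2 * (-g1 * w2 + g2 * w1) / (C.curv * (w1 ^ 2 + w2 ^ 2)) := ⟨_, rfl⟩
  have hs' : 2 * (-g1 * w2 + g2 * w1) + C.curv * s * (w1 ^ 2 + w2 ^ 2) = 0 := by
    subst hs; field_simp; ring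
  have hs0 : s ≠ 0 := by
    intro h0; rw [h0] at hs'; apply hne; linarith
  have e1 : C.eqn ⟨x - s * w2, y + s * w1⟩ = 0 := by
    simp only [eqn, Complex.normSq_apply]
    subst hg1 hg2
    linear_combination hC + s * hs'
  refine ⟨⟨x - s * w2, y + s * w1⟩, ?_, e1, ?_⟩
  · intro h
    rw [Complex.ext_iff] at h
    simp only [sub_eq_self, add_eq_left, mul_eq_zero, hs0, false_or] at h
    apply hW; rw [h.1, h.2]; ring
  · simp only [eqn, Complex.normSq_apply] at e1 ⊢
    apply mul_left_cancel₀ hk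
    subst hg1 hg2 hf1 hf2
    have key : (D.curv * (C.curv * x - C.h₁) - C.curv * (D.curv * x - D.h₁)) * (-(s * w2))
        + (D.curv * (C.curv * y - C.h₂) - C.curv * (D.curv * y - D.h₂)) * (s * w1) = 0 := by
      rw [← hw1, ← hw2]; ring
    linear_combination D.curv * e1 - 2 * key + C.curv * hD - D.curv * hC

theorem Tangent.inner_sq {C D : GenCircle} (h : C.Tangent D) : C.inner D ^ 2 = 1 := by
  by_contra hI
  obtain ⟨p, hp⟩ := h
  have uniq : ∀ a ∈ C.carrier, a ∈ D.carrier → a = p := fun a ha hb => by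
    have : a ∈ C.carrier ∩ D.carrier := ⟨ha, hb⟩
    rwa [hp] at this
  have hpm : p ∈ C.carrier ∩ D.carrier := by rw [hp]; rfl
  have qC := C.quad_eq
  have qD := D.quad_eq
  induction p using OnePoint.rec with
  | infty =>
    have kC := infty_mem_carrier.1 hpm.1
    have kD := infty_mem_carrier.1 hpm.2
    -- two lines that are not parallel meet in a finite point
    simp only [inner, kC, kD] at hI
    rw [kC] at qC
    rw [kD] at qD
    have hdet : C.h₁ * D.h₂ - C.h₂ * D.h₁ ≠ 0 := by
      intro h0
      apply hI
      linear_combination (D.h₁ ^ 2 + D.h₂ ^ 2) * qC + qD - (C.h₁ * D.h₂ - C.h₂ * D.h₁) * h0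
    obtain ⟨x, hx⟩ : ∃ x, x * (2 * (C.h₁ * D.h₂ - C.h₂ * D.h₁))
        = C.cocurv * D.h₂ - D.cocurv * C.h₂ := ⟨_, div_mul_cancel₀ _ (by simpa using hdet)⟩
    obtain ⟨y, hy⟩ : ∃ y, y * (2 * (C.h₁ * D.h₂ - C.h₂ * D.h₁))
        = C.h₁ * D.cocurv - D.h₁ * C.cocurv := ⟨_, div_mul_cancel₀ _ (by simpa using hdet)⟩
    have h1 := uniq ((⟨x, y⟩ : ℂ) : OnePoint ℂ)
      (coe_mem_carrier.2 (by
        apply mul_left_cancel₀ hdet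
        simp only [eqn, kC]
        linear_combination -C.h₁ * hx - C.h₂ * hy))
      (coe_mem_carrier.2 (by
        apply mul_left_cancel₀ hdet
        simp only [eqn, kD]
        linear_combination -D.h₁ * hx - D.h₂ * hy))
    exact OnePoint.coe_ne_infty _ h1
  | coe z =>
    have zC := coe_mem_carrier.1 hpm.1
    have zD := coe_mem_carrier.1 hpm.2
    by_cases kC : C.curv = 0
    · by_cases kD : D.curv = 0
      · exact OnePoint.infty_ne_coe z (uniq _ (infty_mem_carrier.2 kC) (infty_mem_carrier.2 kD))
      · obtain ⟨w, hw, h1, h2⟩ := exists_second_point zD zC kD (by rwa [inner_comm])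
        exact hw (OnePoint.coe_injective (uniq w (coe_mem_carrier.2 h2) (coe_mem_carrier.2 h1)))
    · obtain ⟨w, hw, h1, h2⟩ := exists_second_point zC zD kC hI
      exact hw (OnePoint.coe_injective (uniq w (coe_mem_carrier.2 h1) (coe_mem_carrier.2 h2)))

theorem Tangent.inner_eq_neg_one {C D : GenCircle} (h : C.Tangent D)
    (hd : Disjoint C.interior D.interior) : C.inner D = -1 := by
  exact (sq_eq_sq_iff_eq_or_eq_neg.1 (h.inner_sq.trans (one_pow 2).symm)).resolve_left
    (inner_ne_one_of_disjoint_interior hd)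

/-- The null vector `C + D` is, up to scaling, the point of tangency. -/
theorem tangent_of_inner_eq_neg_one {C D : GenCircle} (h : C.inner D = -1)
    (hk : 0 < C.curv + D.curv) : C.Tangent D := by
  have hC := C.quad_eq
  have hD := D.quad_eq
  simp only [inner] at h
  have hn : (C.h₁ + D.h₁) ^ 2 + (C.h₂ + D.h₂) ^ 2
      = (C.curv + D.curv) * (C.cocurv + D.cocurv) := by
    linear_combination hC + hD + 2 * h
  have hk' := hk.ne'
  have key : ∀ z : ℂ, (C.curv + D.curv) * (C.eqn z + D.eqn z)
      = ((C.curv + D.curv) * z.re - (C.h₁ + D.h₁)) ^ 2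
        + ((C.curv + D.curv) * z.im - (C.h₂ + D.h₂)) ^ 2 := by
    intro z
    simp only [eqn, Complex.normSq_apply]
    linear_combination -hn
  obtain ⟨z, hz⟩ : ∃ z : ℂ, z = ⟨(C.h₁ + D.h₁) / (C.curv + D.curv),
    (C.h₂ + D.h₂) / (C.curv + D.curv)⟩ := ⟨_, rfl⟩
  have hre : (C.curv + D.curv) * z.re = C.h₁ + D.h₁ := by rw [hz]; field_simp
  have him : (C.curv + D.curv) * z.im = C.h₂ + D.h₂ := by rw [hz]; field_simp
  have zC : C.eqn z = 0 := by
    apply mul_left_cancel₀ (pow_ne_zero 2 hk')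
    simp only [eqn, Complex.normSq_apply]
    linear_combination (C.curv * ((C.curv + D.curv) * z.re + (C.h₁ + D.h₁))
        - 2 * (C.curv + D.curv) * C.h₁) * hre
      + (C.curv * ((C.curv + D.curv) * z.im + (C.h₂ + D.h₂))
        - 2 * (C.curv + D.curv) * C.h₂) * him + C.curv * hn
      - 2 * (C.curv + D.curv) * (hC + h)
  have zD : D.eqn z = 0 := by
    have := key z
    rw [hre, him, zC] at this
    simpa [hk'] using this
  refine ⟨z, Set.Subset.antisymm ?_ ?_⟩
  · rintro p ⟨h1, h2⟩
    induction p using OnePoint.rec with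
    | infty =>
      have := infty_mem_carrier.1 h1
      have := infty_mem_carrier.1 h2
      linarith
    | coe w =>
      have e := key w
      rw [coe_mem_carrier.1 h1, coe_mem_carrier.1 h2] at e
      have e1 : (C.curv + D.curv) * w.re - (C.h₁ + D.h₁) = 0 := by
        nlinarith [sq_nonneg ((C.curv + D.curv) * w.re - (C.h₁ + D.h₁)),
          sq_nonneg ((C.curv + D.curv) * w.im - (C.h₂ + D.h₂))]
      have e2 : (C.curv + D.curv) * w.im - (C.h₂ + D.h₂) = 0 := by
        nlinarith [sq_nonneg ((C.curv + D.curv) * w.re - (C.h₁ + D.h₁)),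
          sq_nonneg ((C.curv + D.curv) * w.im - (C.h₂ + D.h₂))]
      have : w = z := by
        apply Complex.ext
        · apply mul_left_cancel₀ hk'; linarith
        · apply mul_left_cancel₀ hk'; linarith
      rw [this]; rfl
  · rintro _ rfl
    exact ⟨coe_mem_carrier.2 zC, coe_mem_carrier.2 zD⟩

end GenCircle

/-! ### The frame of a cubic configuration -/

/-- The space of inversive coordinates `(cocurv, curv, h₁, h₂)`. -/
abbrev InversiveSpace : Type := Fin 4 → ℝ

/-- The Lorentzian inner product of inversive coordinates. -/
noncomputable def lorentz : LinearMap.BilinForm ℝ InversiveSpace :=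
  LinearMap.mk₂ ℝ (fun x y => x 2 * y 2 + x 3 * y 3 - (x 1 * y 0 + x 0 * y 1) / 2)
    (fun x y z => by simp only [Pi.add_apply]; ring)
    (fun c x y => by simp only [Pi.smul_apply, smul_eq_mul]; ring)
    (fun x y z => by simp only [Pi.add_apply]; ring)
    (fun c x y => by simp only [Pi.smul_apply, smul_eq_mul]; ring)

theorem lorentz_apply (x y : InversiveSpace) :
    lorentz x y = x 2 * y 2 + x 3 * y 3 - (x 1 * y 0 + x 0 * y 1) / 2 := rfl

theorem lorentz_comm (x y : InversiveSpace) : lorentz x y = lorentz y x := by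
  simp only [lorentz_apply]; ring

/-- The inversive coordinates of an oriented generalized circle. -/
def GenCircle.vec (C : GenCircle) : InversiveSpace := ![C.cocurv, C.curv, C.h₁, C.h₂]

theorem GenCircle.vec_curv (C : GenCircle) : C.vec 1 = C.curv := rfl

theorem GenCircle.lorentz_vec (C D : GenCircle) : lorentz C.vec D.vec = C.inner D := by
  simp [lorentz_apply, GenCircle.vec, GenCircle.inner]

theorem GenCircle.lorentz_vec_self (C : GenCircle) : lorentz C.vec C.vec = 1 := by
  have := C.quad_eq
  rw [GenCircle.lorentz_vec, GenCircle.inner]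
  linear_combination this

/-- The `±1` attached to a coordinate of a vertex of the cube. -/
def boolSign (s : Bool) : ℝ := if s then 1 else -1

@[simp] theorem boolSign_true : boolSign true = 1 := rfl

@[simp] theorem boolSign_false : boolSign false = -1 := rfl

@[simp] theorem boolSign_not (s : Bool) : boolSign (!s) = -boolSign s := by cases s <;> simp

theorem boolSign_mul_self (s : Bool) : boolSign s * boolSign s = 1 := by cases s <;> simp

theorem exists_coords_of_orthogonal {m : InversiveSpace} {u : Fin 3 → InversiveSpace}
    (hm : m ≠ 0) (hu : ∀ i, lorentz (u i) (u i) ≠ 0)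
    (huu : ∀ i j, i ≠ j → lorentz (u i) (u j) = 0) (hmu : ∀ i, lorentz m (u i) = 0)
    (x : InversiveSpace) : ∃ (t : ℝ) (β : Fin 3 → ℝ), x = t • m + ∑ i, β i • u i := by
  have hli : LinearIndependent ℝ (Fin.cons m u : Fin 4 → InversiveSpace) := by
    rw [Fintype.linearIndependent_iff]
    intro g hg
    rw [Fin.sum_univ_succ] at hg
    simp only [Fin.cons_zero, Fin.cons_succ] at hg
    have hs : ∀ j : Fin 3, g j.succ = 0 := by
      intro j
      have := congrArg (fun y => lorentz y (u j)) hg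
      simp only [map_add, map_smul, map_sum, LinearMap.add_apply, LinearMap.smul_apply,
        LinearMap.sum_apply, hmu, map_zero, LinearMap.zero_apply, smul_eq_mul, mul_zero,
        zero_add] at this
      rw [Finset.sum_eq_single j (fun i _ hij => by rw [huu i j hij, mul_zero])
        (fun h => absurd (Finset.mem_univ j) h)] at this
      exact (mul_eq_zero.1 this).resolve_right (hu j)
    simp only [hs, zero_smul, Finset.sum_const_zero, add_zero, smul_eq_zero, hm, or_false] at hg
    exact Fin.cases hg hs
  have hspan := hli.span_eq_top_of_card_eq_finrank' (by simp)
  have hx : x ∈ Submodule.span ℝ (Set.range (Fin.cons m u : Fin 4 → InversiveSpace)) := by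
    rw [hspan]; trivial
  obtain ⟨c, hc⟩ := (Submodule.mem_span_range_iff_exists_fun ℝ).1 hx
  refine ⟨c 0, fun i => c i.succ, ?_⟩
  rw [← hc, Fin.sum_univ_succ]
  simp

/-- An orthogonal basis of the Lorentz space that describes a cubic configuration: `P` is
proportional to the time axis of the configuration and the `W i` to the three directions of the
cube. -/
structure IsCubeFrame (P : InversiveSpace) (W : Fin 3 → InversiveSpace) : Prop where
  center_self : lorentz P P = -2
  center_edge : ∀ i, lorentz P (W i) = 0
  edge_edge : ∀ i j, lorentz (W i) (W j) = if i = j then 1 else 0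

namespace IsCubeFrame

variable {P : InversiveSpace} {W : Fin 3 → InversiveSpace}

theorem edge_center (h : IsCubeFrame P W) (i : Fin 3) : lorentz (W i) P = 0 := by
  rw [lorentz_comm, h.center_edge]

theorem expand (h : IsCubeFrame P W) (x : InversiveSpace) :
    x = (-(1 / 2) * lorentz x P) • P + ∑ i, lorentz x (W i) • W i := by
  have hP : P ≠ 0 := by
    rintro rfl
    have := h.center_self
    simp at this
  obtain ⟨t, β, hx⟩ := exists_coords_of_orthogonal (u := W) hP
    (fun i => by rw [h.edge_edge]; simp) (fun i j hij => by rw [h.edge_edge, if_neg hij])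
    h.center_edge x
  have ht : lorentz x P = -2 * t := by
    rw [hx]
    simp [h.center_self, h.edge_center]
    ring
  have hβ : ∀ j, lorentz x (W j) = β j := by
    intro j
    rw [hx]
    simp [h.center_edge, h.edge_edge]
  rw [ht]
  simp only [hβ]
  rw [show -(1 / 2) * (-2 * t) = t by ring]
  exact hx

/-- The curvature functional is the inner product with a null vector. -/
theorem curv_rel (h : IsCubeFrame P W) : P 1 ^ 2 = 2 * ∑ i, W i 1 ^ 2 := by
  have hN : ∀ x, lorentz (![-2, 0, 0, 0] : InversiveSpace) x = x 1 := by
    intro x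
    simp [lorentz_apply]
    ring
  have := congrArg (lorentz (![-2, 0, 0, 0] : InversiveSpace))
    (h.expand (![-2, 0, 0, 0] : InversiveSpace))
  simp only [hN, Pi.add_apply, Pi.smul_apply, Finset.sum_apply, smul_eq_mul] at this
  simp only [Matrix.cons_val_one, Matrix.cons_val_zero] at this
  simp only [pow_two]
  linarith

/-- The vertex `v` of the cube with centre `P` and half edges `W i`. -/
def vertex (P : InversiveSpace) (W : Fin 3 → InversiveSpace) (v : CubeVertex) : InversiveSpace :=
  P + ∑ i, boolSign (v i) • W i

end IsCubeFrame

namespace CubicConfiguration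

variable (B : CubicConfiguration)

theorem dual_lorentz {F G : CubeFace} (h : F.1 ≠ G.1) :
    lorentz (B.dual F).vec (B.dual G).vec = -1 := by
  rw [GenCircle.lorentz_vec]
  exact (B.dual_tangent F G h).inner_eq_neg_one
    (B.dual_interior F G (fun e => h (congrArg Prod.fst e)))

theorem base_lorentz {v w : CubeVertex} (h : CubeVertex.Adj v w) (hne : v ≠ w) :
    lorentz (B.base v).vec (B.base w).vec = -1 := by
  rw [GenCircle.lorentz_vec]
  exact (B.base_tangent v w h).inner_eq_neg_one (B.base_interior v w hne)

/-- The difference of two opposite dual circles. -/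
noncomputable def dualDiff (i : Fin 3) : InversiveSpace :=
  (B.dual (i, true)).vec - (B.dual (i, false)).vec

/-- The sum of two opposite dual circles. -/
noncomputable def dualSum (i : Fin 3) : InversiveSpace :=
  (B.dual (i, true)).vec + (B.dual (i, false)).vec

theorem dual_vec (i : Fin 3) (s : Bool) :
    (B.dual (i, s)).vec = (1 / 2 : ℝ) • (B.dualSum i + boolSign s • B.dualDiff i) := by
  cases s <;> ext k <;> simp [dualSum, dualDiff] <;> ring

theorem dualDiff_orthogonal {i j : Fin 3} (h : i ≠ j) :
    lorentz (B.dualDiff i) (B.dualDiff j) = 0 := by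
  simp only [dualDiff, map_sub, LinearMap.sub_apply]
  simp [B.dual_lorentz (F := (i, _)) (G := (j, _)) h]

theorem dualSum_dualDiff (i j : Fin 3) : lorentz (B.dualSum i) (B.dualDiff j) = 0 := by
  simp only [dualSum, dualDiff, map_sub, map_add, LinearMap.add_apply]
  rcases eq_or_ne i j with rfl | h
  · simp only [GenCircle.lorentz_vec_self]
    rw [lorentz_comm (B.dual (i, false)).vec (B.dual (i, true)).vec]
    ring
  · simp [B.dual_lorentz (F := (i, _)) (G := (j, _)) h]

theorem dualSum_dualSum {i j : Fin 3} (h : i ≠ j) :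
    lorentz (B.dualSum i) (B.dualSum j) = -4 := by
  simp only [dualSum, map_add, LinearMap.add_apply]
  simp only [B.dual_lorentz (F := (i, _)) (G := (j, _)) h]
  norm_num

theorem dualDiff_self (i : Fin 3) :
    lorentz (B.dualDiff i) (B.dualDiff i) = 4 - lorentz (B.dualSum i) (B.dualSum i) := by
  simp only [dualSum, dualDiff, map_sub, map_add, LinearMap.add_apply, LinearMap.sub_apply,
    GenCircle.lorentz_vec_self]
  ring

theorem dualDiff_self_ne_zero (i : Fin 3) : lorentz (B.dualDiff i) (B.dualDiff i) ≠ 0 := by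
  intro h
  refine GenCircle.inner_ne_one_of_disjoint_interior
    (B.dual_interior (i, true) (i, false) (by simp)) ?_
  simp only [dualDiff, map_sub, LinearMap.sub_apply, GenCircle.lorentz_vec_self] at h
  rw [lorentz_comm (B.dual (i, false)).vec, GenCircle.lorentz_vec] at h
  linarith

theorem dualSum_ne_zero (i : Fin 3) : B.dualSum i ≠ 0 := by
  intro h
  obtain ⟨j, hj⟩ : ∃ j : Fin 3, i ≠ j := (exists_ne i).imp fun _ h => h.symm
  have := B.dualSum_dualSum hj
  rw [h] at this
  simp at this

/-- The sums of opposite dual circles span the line orthogonal to the three differences; their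
inner products then force them to be equal. -/
theorem dualSum_eq (i j : Fin 3) : B.dualSum i = B.dualSum j := by
  have hmul : ∀ i, ∃ t : ℝ, B.dualSum i = t • B.dualSum 0 := by
    intro i
    obtain ⟨t, β, h⟩ := exists_coords_of_orthogonal (u := B.dualDiff) (B.dualSum_ne_zero 0)
      B.dualDiff_self_ne_zero (fun i j h => B.dualDiff_orthogonal h) (B.dualSum_dualDiff 0)
      (B.dualSum i)
    refine ⟨t, ?_⟩
    have hβ : ∀ k, β k = 0 := by
      intro k
      have := congrArg (fun y => lorentz y (B.dualDiff k)) h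
      simp only [map_add, map_smul, map_sum, LinearMap.add_apply, LinearMap.smul_apply,
        LinearMap.sum_apply, B.dualSum_dualDiff, smul_eq_mul, mul_zero, zero_add] at this
      rw [Finset.sum_eq_single k (fun i _ hij => by rw [B.dualDiff_orthogonal hij, mul_zero])
        (fun h => absurd (Finset.mem_univ k) h)] at this
      exact (mul_eq_zero.1 this.symm).resolve_right (B.dualDiff_self_ne_zero k)
    rw [h]
    simp [hβ]
  obtain ⟨t₁, h₁⟩ := hmul 1
  obtain ⟨t₂, h₂⟩ := hmul 2
  have e1 := B.dualSum_dualSum (i := 0) (j := 1) (by decide)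
  have e2 := B.dualSum_dualSum (i := 0) (j := 2) (by decide)
  have e3 := B.dualSum_dualSum (i := 1) (j := 2) (by decide)
  rw [h₁] at e1 e3
  rw [h₂] at e2 e3
  simp only [map_smul, LinearMap.smul_apply, smul_eq_mul] at e1 e2 e3
  have hn : lorentz (B.dualSum 0) (B.dualSum 0) ≠ 0 := by
    intro h0; rw [h0] at e1; norm_num at e1
  have ht₂ : t₂ = 1 := by
    have : t₁ * lorentz (B.dualSum 0) (B.dualSum 0) * (t₂ - 1) = 0 := by linear_combination e3 - e1
    rw [e1] at this; linarith
  have ht₁ : t₁ = 1 := by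
    apply mul_right_cancel₀ hn; rw [e1, ← e2, ht₂]
  have h0 : ∀ i, B.dualSum i = B.dualSum 0 := by
    intro i
    fin_cases i
    · rfl
    · simpa [ht₁] using h₁
    · simpa [ht₂] using h₂
  rw [h0 i, h0 j]

theorem dualSum_self (i : Fin 3) : lorentz (B.dualSum i) (B.dualSum i) = -4 := by
  obtain ⟨j, hj⟩ : ∃ j : Fin 3, i ≠ j := (exists_ne i).imp fun _ h => h.symm
  have := B.dualSum_dualSum hj
  rwa [B.dualSum_eq j i] at this

/-- A base circle is determined up to sign by its orthogonality to three dual circles. -/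
theorem base_vec (v : CubeVertex) : ∃ t : ℝ, t ^ 2 = 1 / 2 ∧
    (B.base v).vec = t • (B.dualSum 0 + ∑ i, (boolSign (v i) / 2) • B.dualDiff i) := by
  obtain ⟨t, β, h⟩ := exists_coords_of_orthogonal (u := B.dualDiff) (B.dualSum_ne_zero 0)
      B.dualDiff_self_ne_zero (fun i j h => B.dualDiff_orthogonal h) (B.dualSum_dualDiff 0)
      (B.base v).vec
  have huu : ∀ i j, lorentz (B.dualDiff i) (B.dualDiff j) = if i = j then 8 else 0 := by
    intro i j
    split_ifs with hij
    · rw [hij, B.dualDiff_self, B.dualSum_self]; norm_num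
    · exact B.dualDiff_orthogonal hij
  have hum : ∀ i j, lorentz (B.dualDiff i) (B.dualSum j) = 0 := fun i j => by
    rw [lorentz_comm, B.dualSum_dualDiff]
  have hβ : ∀ k, β k = t * (boolSign (v k) / 2) := by
    intro k
    have e : lorentz (B.base v).vec (B.dual (k, v k)).vec = 0 := by
      rw [GenCircle.lorentz_vec]
      exact B.incident_orthogonal v (k, v k) rfl
    rw [B.dual_vec, B.dualSum_eq k 0, h] at e
    simp [huu, B.dualSum_dualDiff, hum, B.dualSum_self] at e
    linear_combination (boolSign (v k) / 4) * e - β k * boolSign_mul_self (v k)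
  refine ⟨t, ?_, ?_⟩
  · have e := (B.base v).lorentz_vec_self
    rw [h] at e
    simp [huu, B.dualSum_dualDiff, hum, B.dualSum_self, Fin.sum_univ_three, hβ] at e
    linear_combination (1 / 2) * e - t ^ 2 * boolSign_mul_self (v 0)
      - t ^ 2 * boolSign_mul_self (v 1) - t ^ 2 * boolSign_mul_self (v 2)
  · rw [h]
    simp only [hβ, smul_add, Finset.smul_sum, smul_smul]

theorem flip_apply (v : CubeVertex) (k i : Fin 3) :
    v.flip k i = if i = k then !(v i) else v i := by
  unfold CubeVertex.flip
  by_cases h : i = k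
  · subst h; simp
  · simp [h]

theorem ne_flip (v : CubeVertex) (k : Fin 3) : v ≠ v.flip k := by
  intro h
  have := congrFun h k
  simp [flip_apply] at this

theorem flip_induction {p : CubeVertex → Prop} (v : CubeVertex) (h : p v)
    (hs : ∀ w k, p w → p (w.flip k)) (w : CubeVertex) : p w := by
  -- flip, one after the other, the coordinates in which `v` and `w` differ
  have step : ∀ u : CubeVertex, ∀ k : Fin 3, ∀ b, p u → p (Function.update u k b) := by
    intro u k b hu
    by_cases hb : b = u k
    · rwa [hb, Function.update_eq_self]
    · have : b = !(u k) := by cases b <;> cases hk : u k <;> simp_all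
      rw [this]
      exact hs u k hu
  have := step _ 2 (w 2) (step _ 1 (w 1) (step v 0 (w 0) h))
  convert this using 1
  funext i
  fin_cases i <;> simp [Function.update]

/-- The base octuple is the image of the vertices of a cube under an affine map of the inversive
space, and the dual circles are determined, up to orientation, by the same frame. -/
theorem exists_base_frame : ∃ P W, IsCubeFrame P W ∧
    (∀ v, (B.base v).vec = IsCubeFrame.vertex P W v) ∧
    ∀ i s, ∃ t : ℝ, t ^ 2 = 1 / 2 ∧ (B.dual (i, s)).vec = t • (P + (2 * boolSign s) • W i) := by
  have huu : ∀ i j, lorentz (B.dualDiff i) (B.dualDiff j) = if i = j then 8 else 0 := by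
    intro i j
    split_ifs with hij
    · rw [hij, B.dualDiff_self, B.dualSum_self]; norm_num
    · exact B.dualDiff_orthogonal hij
  have hum : ∀ i j, lorentz (B.dualDiff i) (B.dualSum j) = 0 := fun i j => by
    rw [lorentz_comm, B.dualSum_dualDiff]
  choose t ht hv using B.base_vec
  have htt : ∀ v k, t (v.flip k) = t v := by
    intro v k
    have e := B.base_lorentz ⟨k, rfl⟩ (ne_flip v k)
    rw [hv v, hv (v.flip k)] at e
    simp [huu, B.dualSum_dualDiff, hum, B.dualSum_self, Fin.sum_univ_three, flip_apply] at e
    have e' : t v * t (v.flip k) = 1 / 2 := by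
      have s0 := boolSign_mul_self (v 0)
      have s1 := boolSign_mul_self (v 1)
      have s2 := boolSign_mul_self (v 2)
      fin_cases k
      all_goals
        simp at e
        simp
        first
        | linear_combination (-1 / 2) * e + t v * t (v.flip 0) * (-s0 + s1 + s2)
        | linear_combination (-1 / 2) * e + t v * t (v.flip 1) * (s0 - s1 + s2)
        | linear_combination (-1 / 2) * e + t v * t (v.flip 2) * (s0 + s1 - s2)
    have h0 : (t (v.flip k) - t v) ^ 2 = 0 := by
      linear_combination ht (v.flip k) + ht v - 2 * e'
    linarith [pow_eq_zero_iff (two_ne_zero) |>.1 h0]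
  obtain ⟨τ, hτ⟩ : ∃ τ, ∀ v, t v = τ :=
    ⟨_, fun v => flip_induction (p := fun v => t v = t (fun _ => true)) (fun _ => true) rfl
      (fun w k h => by rw [htt, h]) v⟩
  have hτ2 : τ ^ 2 = 1 / 2 := by rw [← hτ fun _ => true, ht]
  have hτ0 : τ ≠ 0 := by rintro rfl; norm_num at hτ2
  refine ⟨τ • B.dualSum 0, fun i => (τ / 2) • B.dualDiff i, ⟨?_, ?_, ?_⟩, ?_, ?_⟩
  · simp [B.dualSum_self]; linear_combination 4 * hτ2
  · intro i; simp [B.dualSum_dualDiff]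
  · intro i j
    have : τ / 2 * (τ / 2 * 8) = 1 := by linear_combination 2 * hτ2
    simp [huu, this]
  · intro v
    rw [hv, hτ, IsCubeFrame.vertex]
    simp only [smul_add, Finset.smul_sum, smul_smul]
    congr 1
    refine Finset.sum_congr rfl fun i _ => ?_
    congr 1; ring
  · intro i s
    refine ⟨τ, hτ2, ?_⟩
    rw [B.dual_vec, B.dualSum_eq i 0]
    simp only [smul_add, smul_smul]
    congr 2
    · linear_combination -hτ2
    · linear_combination -boolSign s * hτ2

end CubicConfiguration

/-! ### Reflections, octuples and their common lattice -/

/-- Reflection in the hyperplane orthogonal to a vector `d` of norm `1`. -/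
noncomputable def lorentzReflection (d : InversiveSpace) : InversiveSpace →ₗ[ℝ] InversiveSpace :=
  LinearMap.id - (2 : ℝ) • (lorentz.flip d).smulRight d

theorem lorentzReflection_apply (d x : InversiveSpace) :
    lorentzReflection d x = x - (2 * lorentz x d) • d := by
  simp [lorentzReflection, smul_smul]

theorem lorentz_lorentzReflection {d : InversiveSpace} (hd : lorentz d d = 1)
    (x y : InversiveSpace) :
    lorentz (lorentzReflection d x) (lorentzReflection d y) = lorentz x y := by
  simp only [lorentzReflection_apply, map_sub, LinearMap.sub_apply, map_smul,
    LinearMap.smul_apply, smul_eq_mul, hd, lorentz_comm d y]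
  ring

theorem lorentzReflection_lorentzReflection {d : InversiveSpace} (hd : lorentz d d = 1)
    (x : InversiveSpace) : lorentzReflection d (lorentzReflection d x) = x := by
  simp only [lorentzReflection_apply, map_sub, map_smul, hd]
  module

theorem GenCircle.vec_reflect (M C : GenCircle) :
    (M.reflect C).vec = lorentzReflection M.vec C.vec := by
  rw [lorentzReflection_apply, GenCircle.lorentz_vec]
  ext k
  fin_cases k <;> simp [GenCircle.vec, GenCircle.reflect]

theorem GenCircle.reflect_of_orthogonal {M C : GenCircle} (h : C.Orthogonal M) :
    M.reflect C = C := by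
  unfold GenCircle.Orthogonal at h
  ext <;> simp [GenCircle.reflect, h]

/-- The identity behind time orientation: it shows that for timelike vectors with negative inner
product the coordinates with index `1` (the curvatures) have the same sign. -/
theorem curv_mul_curv_identity (x y : InversiveSpace) :
    2 * (x 1 * y 1) * lorentz x y = y 1 ^ 2 * lorentz x x + x 1 ^ 2 * lorentz y y
      - (y 1 * x 2 - x 1 * y 2) ^ 2 - (y 1 * x 3 - x 1 * y 3) ^ 2 := by
  simp only [lorentz_apply]; ring

theorem curv_pos_of_timelike {x y : InversiveSpace} (hx : lorentz x x < 0) (hy : lorentz y y < 0)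
    (hxy : lorentz x y < 0) (h : 0 < x 1) : 0 < y 1 := by
  have := curv_mul_curv_identity x y
  by_contra! hn
  have h1 : 0 ≤ 2 * (x 1 * y 1) * lorentz x y :=
    mul_nonneg_of_nonpos_of_nonpos (by nlinarith) hxy.le
  have h2 : y 1 ^ 2 * lorentz x x ≤ 0 := mul_nonpos_of_nonneg_of_nonpos (sq_nonneg _) hx.le
  have h3 : x 1 ^ 2 * lorentz y y < 0 := mul_neg_of_pos_of_neg (by positivity) hy
  nlinarith [sq_nonneg (y 1 * x 2 - x 1 * y 2), sq_nonneg (y 1 * x 3 - x 1 * y 3)]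

namespace IsCubeFrame

variable {P : InversiveSpace} {W : Fin 3 → InversiveSpace}

theorem map_reflection (h : IsCubeFrame P W) {d : InversiveSpace} (hd : lorentz d d = 1) :
    IsCubeFrame (lorentzReflection d P) (fun i => lorentzReflection d (W i)) where
  center_self := by rw [lorentz_lorentzReflection hd, h.center_self]
  center_edge i := by rw [lorentz_lorentzReflection hd, h.center_edge]
  edge_edge i j := by rw [lorentz_lorentzReflection hd, h.edge_edge]

theorem vertex_map_reflection (d : InversiveSpace) (v : CubeVertex) :
    vertex (lorentzReflection d P) (fun i => lorentzReflection d (W i)) v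
      = lorentzReflection d (vertex P W v) := by
  simp [vertex]

theorem center_curv_ne_zero (h : IsCubeFrame P W) : P 1 ≠ 0 := by
  intro h0
  have := h.center_self
  rw [lorentz_apply, h0] at this
  nlinarith [sq_nonneg (P 2), sq_nonneg (P 3)]

theorem center_reflection_curv_pos (h : IsCubeFrame P W) (hP : 0 < P 1) {d : InversiveSpace}
    (hd : lorentz d d = 1) : 0 < lorentzReflection d P 1 := by
  refine curv_pos_of_timelike (x := P) (by rw [h.center_self]; norm_num)
    (by rw [lorentz_lorentzReflection hd, h.center_self]; norm_num) ?_ hP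
  rw [lorentzReflection_apply, map_sub, map_smul, h.center_self, smul_eq_mul]
  nlinarith [sq_nonneg (lorentz P d)]

theorem vertex_add_antipode (v : CubeVertex) :
    vertex P W v + vertex P W (fun i => !(v i)) = (2 : ℝ) • P := by
  simp only [vertex, Fin.sum_univ_three, boolSign_not]
  module

theorem vertex_flip (v : CubeVertex) (k : Fin 3) :
    vertex P W (v.flip k) = vertex P W v - (2 * boolSign (v k)) • W k := by
  simp only [vertex, Fin.sum_univ_three, CubicConfiguration.flip_apply]
  fin_cases k <;> simp <;> module

/-- The additive group generated by the vertices of a cube. -/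
def lattice (P : InversiveSpace) (W : Fin 3 → InversiveSpace) : AddSubgroup InversiveSpace :=
  AddSubgroup.closure (Set.range (vertex P W))

theorem vertex_mem_lattice (v : CubeVertex) : vertex P W v ∈ lattice P W :=
  AddSubgroup.subset_closure ⟨v, rfl⟩

theorem lattice_map_reflection (d : InversiveSpace) :
    lattice (lorentzReflection d P) (fun i => lorentzReflection d (W i))
      = (lattice P W).map (lorentzReflection d).toAddMonoidHom := by
  rw [lattice, lattice, AddMonoidHom.map_closure, ← Set.range_comp]
  congr 2
  funext v
  exact vertex_map_reflection d v

/-- The reflections in the dual circles preserve the lattice generated by the octuple. -/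
theorem lattice_map_dual_reflection (h : IsCubeFrame P W) {t : ℝ} (ht : t ^ 2 = 1 / 2)
    (i : Fin 3) (s : Bool) {d : InversiveSpace} (hd : lorentz d d = 1)
    (hdt : d = t • (P + (2 * boolSign s) • W i)) :
    (lattice P W).map (lorentzReflection d).toAddMonoidHom = lattice P W := by
  have key : (lattice P W).map (lorentzReflection d).toAddMonoidHom ≤ lattice P W := by
    rw [lattice, AddMonoidHom.map_closure, AddSubgroup.closure_le]
    rintro _ ⟨_, ⟨v, rfl⟩, rfl⟩
    have hin : lorentz (vertex P W v) (P + (2 * boolSign s) • W i)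
        = -2 + 2 * boolSign s * boolSign (v i) := by
      simp [vertex, h.center_self, h.center_edge, h.edge_center, h.edge_edge]
      ring
    have hr : lorentzReflection d (vertex P W v) = vertex P W v
        - (-2 + 2 * boolSign s * boolSign (v i)) • (P + (2 * boolSign s) • W i) := by
      rw [lorentzReflection_apply, hdt, map_smul, hin, smul_smul, smul_eq_mul]
      congr 2
      linear_combination 2 * (-2 + 2 * boolSign s * boolSign (v i)) * ht
    change lorentzReflection d (vertex P W v) ∈ lattice P W
    rw [hr]
    rcases eq_or_ne s (v i) with hs | hs
    · rw [hs, mul_assoc, boolSign_mul_self]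
      norm_num
      exact vertex_mem_lattice v
    · have hs' : boolSign s = -boolSign (v i) := by
        cases s <;> cases hv : v i <;> simp_all
      have e : vertex P W v - (-2 + 2 * boolSign s * boolSign (v i)) •
          (P + (2 * boolSign s) • W i) = vertex P W v
            + (2 : ℤ) • (vertex P W v + vertex P W (fun i => !(v i)))
            + (4 : ℤ) • (vertex P W (v.flip i) - vertex P W v) := by
        rw [vertex_add_antipode, vertex_flip, hs',
          show -2 + 2 * -boolSign (v i) * boolSign (v i) = -4 by
            linear_combination -2 * boolSign_mul_self (v i)]
        module
      rw [e]
      exact add_mem (add_mem (vertex_mem_lattice v)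
        (zsmul_mem (add_mem (vertex_mem_lattice v) (vertex_mem_lattice _)) 2))
        (zsmul_mem (sub_mem (vertex_mem_lattice _) (vertex_mem_lattice v)) 4)
  refine le_antisymm key fun x hx => ?_
  exact ⟨lorentzReflection d x, key ⟨x, hx, rfl⟩, lorentzReflection_lorentzReflection hd x⟩

/-- The sum of the adjacent vertices `v` and `v.flip k`: a null vector that represents the point of
tangency of the two circles. -/
def nullVec (P : InversiveSpace) (W : Fin 3 → InversiveSpace) (v : CubeVertex) (k : Fin 3) :
    InversiveSpace :=
  vertex P W v + vertex P W (v.flip k)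

theorem vertex_self (h : IsCubeFrame P W) (v : CubeVertex) :
    lorentz (vertex P W v) (vertex P W v) = 1 := by
  simp [vertex, h.center_self, h.center_edge, h.edge_center, h.edge_edge, boolSign_mul_self]
  norm_num

theorem vertex_edge (h : IsCubeFrame P W) (v : CubeVertex) (k : Fin 3) :
    lorentz (vertex P W v) (W k) = boolSign (v k) := by
  simp [vertex, h.center_edge, h.edge_edge]

theorem vertex_vertex_flip (h : IsCubeFrame P W) (v : CubeVertex) (k : Fin 3) :
    lorentz (vertex P W v) (vertex P W (v.flip k)) = -1 := by
  rw [vertex_flip, map_sub, map_smul, h.vertex_self, h.vertex_edge, smul_eq_mul]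
  linear_combination -2 * boolSign_mul_self (v k)

theorem vertex_nullVec (h : IsCubeFrame P W) (v : CubeVertex) (k : Fin 3) :
    lorentz (vertex P W v) (nullVec P W v k) = 0 := by
  rw [nullVec, map_add, h.vertex_self, h.vertex_vertex_flip]; norm_num

theorem vertex_sum_nullVec (h : IsCubeFrame P W) (v : CubeVertex) (n : Fin 3 → ℤ) :
    lorentz (vertex P W v) (∑ k, n k • nullVec P W v k) = 0 := by
  simp only [map_sum, map_zsmul, h.vertex_nullVec, smul_zero, Finset.sum_const_zero]

theorem nullVec_nullVec (h : IsCubeFrame P W) (v : CubeVertex) (j k : Fin 3) :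
    lorentz (nullVec P W v j) (nullVec P W v k) = if j = k then 0 else -4 := by
  have hW : ∀ i, lorentz (W i) (vertex P W v) = boolSign (v i) := fun i => by
    rw [lorentz_comm, h.vertex_edge]
  simp only [nullVec, vertex_flip, map_add, map_sub, map_smul, LinearMap.add_apply,
    LinearMap.sub_apply, LinearMap.smul_apply, smul_eq_mul, h.vertex_self, h.vertex_edge, hW,
    h.edge_edge]
  split_ifs with hjk
  · subst hjk
    linear_combination (-4) * boolSign_mul_self (v j)
  · linear_combination (-4) * boolSign_mul_self (v j) - 4 * boolSign_mul_self (v k)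

theorem nullVec_eq (v : CubeVertex) (k : Fin 3) :
    nullVec P W v k = (2 : ℝ) • vertex P W v - (2 * boolSign (v k)) • W k := by
  rw [nullVec, vertex_flip]; module

theorem exists_coeff_of_mem_lattice (v : CubeVertex) {x : InversiveSpace}
    (hx : x ∈ lattice P W) : ∃ (c : ℤ) (n : Fin 3 → ℤ),
      x = c • vertex P W v + ∑ k, n k • nullVec P W v k := by
  induction hx using AddSubgroup.closure_induction with
  | mem x hx =>
    obtain ⟨w, rfl⟩ := hx
    -- `w` is reached from `v` by flipping the coordinates in which they differ
    have hw : vertex P W w = vertex P W v + ∑ k, (if w k = v k then (0 : ℤ) else 1) •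
        (vertex P W (v.flip k) - vertex P W v) := by
      have : ∀ k, (if w k = v k then (0 : ℤ) else 1) • (vertex P W (v.flip k) - vertex P W v)
          = (boolSign (w k) - boolSign (v k)) • W k := by
        intro k
        rw [vertex_flip]
        split_ifs with hk
        · simp [hk]
        · have : boolSign (w k) = -boolSign (v k) := by
            cases hw : w k <;> cases hv : v k <;> simp_all
          rw [this]
          module
      simp only [this]
      simp only [vertex, Fin.sum_univ_three]
      module
    refine ⟨1 - 2 * ∑ k, (if w k = v k then (0 : ℤ) else 1),
      fun k => if w k = v k then (0 : ℤ) else 1, ?_⟩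
    rw [hw]
    simp only [Fin.sum_univ_three, nullVec]
    module
  | zero => exact ⟨0, 0, by simp⟩
  | add x y _ _ hx hy =>
    obtain ⟨c, n, rfl⟩ := hx
    obtain ⟨d, m, rfl⟩ := hy
    refine ⟨c + d, n + m, ?_⟩
    simp only [Fin.sum_univ_three, Pi.add_apply]
    module
  | neg x _ hx =>
    obtain ⟨c, n, rfl⟩ := hx
    refine ⟨-c, -n, ?_⟩
    simp only [Fin.sum_univ_three, Pi.neg_apply]
    module

theorem nullVec_mem_lattice (v : CubeVertex) (k : Fin 3) : nullVec P W v k ∈ lattice P W :=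
  add_mem (vertex_mem_lattice _) (vertex_mem_lattice _)

/-- The part of the lattice orthogonal to a vertex `v` is generated by the vectors
`nullVec P W v k`. -/
theorem exists_coeff_of_orthogonal (h : IsCubeFrame P W) (v : CubeVertex) {x : InversiveSpace}
    (hx : x ∈ lattice P W) (hxv : lorentz (vertex P W v) x = 0) :
    ∃ n : Fin 3 → ℤ, x = ∑ k, n k • nullVec P W v k := by
  obtain ⟨c, n, rfl⟩ := exists_coeff_of_mem_lattice v hx
  have hc : (c : ℝ) = 0 := by
    rw [map_add, h.vertex_sum_nullVec, map_zsmul, h.vertex_self, add_zero, zsmul_one] at hxv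
    exact hxv
  refine ⟨n, ?_⟩
  rw [Int.cast_eq_zero.1 hc]
  simp

theorem sum_nullVec_self (h : IsCubeFrame P W) (v : CubeVertex) (n : Fin 3 → ℤ) :
    lorentz (∑ k, n k • nullVec P W v k) (∑ k, n k • nullVec P W v k)
      = -8 * ((n 0 * n 1 + n 0 * n 2 + n 1 * n 2 : ℤ) : ℝ) := by
  simp only [Fin.sum_univ_three, map_add, map_zsmul, LinearMap.add_apply, LinearMap.smul_apply,
    h.nullVec_nullVec]
  simp
  ring

theorem eq_of_sum_nullVec_eq (h : IsCubeFrame P W) (v : CubeVertex) {n m : Fin 3 → ℤ}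
    (he : ∑ k, n k • nullVec P W v k = ∑ k, m k • nullVec P W v k) : n = m := by
  have hj : ∀ j, lorentz (∑ k, n k • nullVec P W v k) (nullVec P W v j)
      = lorentz (∑ k, m k • nullVec P W v k) (nullVec P W v j) := fun j => by rw [he]
  simp only [Fin.sum_univ_three, map_add, map_zsmul, LinearMap.add_apply, LinearMap.smul_apply,
    h.nullVec_nullVec] at hj
  have h0 := hj 0
  have h1 := hj 1
  have h2 := hj 2
  simp at h0 h1 h2
  have e0 : (n 0 : ℝ) = m 0 := by linarith
  have e1 : (n 1 : ℝ) = m 1 := by linarith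
  have e2 : (n 2 : ℝ) = m 2 := by linarith
  funext k
  fin_cases k
  · exact_mod_cast e0
  · exact_mod_cast e1
  · exact_mod_cast e2

/-- The primitive null vectors of the lattice orthogonal to a vertex do not depend on the cube
chosen to describe the lattice. -/
theorem exists_primitive_coeff {P' : InversiveSpace} {W' : Fin 3 → InversiveSpace}
    (h : IsCubeFrame P W) (h' : IsCubeFrame P' W') (hL : lattice P W = lattice P' W')
    {v v' : CubeVertex} (hv : vertex P W v = vertex P' W' v') {n' : Fin 3 → ℤ}
    (hn : n' 0 * n' 1 + n' 0 * n' 2 + n' 1 * n' 2 = 0)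
    (hp : ∀ d : ℤ, (∀ k, d ∣ n' k) → IsUnit d) :
    ∃ n : Fin 3 → ℤ, n 0 * n 1 + n 0 * n 2 + n 1 * n 2 = 0 ∧
      (∀ d : ℤ, (∀ k, d ∣ n k) → IsUnit d) ∧
      ∑ k, n k • nullVec P W v k = ∑ k, n' k • nullVec P' W' v' k := by
  obtain ⟨n, hx⟩ := h.exists_coeff_of_orthogonal v (x := ∑ k, n' k • nullVec P' W' v' k)
    (by rw [hL]; exact sum_mem fun k _ => zsmul_mem (nullVec_mem_lattice v' k) _)
    (by rw [hv]; exact h'.vertex_sum_nullVec v' n')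
  refine ⟨n, ?_, ?_, hx.symm⟩
  · have e := h.sum_nullVec_self v n
    rw [← hx, h'.sum_nullVec_self, hn] at e
    have : ((n 0 * n 1 + n 0 * n 2 + n 1 * n 2 : ℤ) : ℝ) = 0 := by
      simp only [Int.cast_zero, mul_zero] at e; linarith
    exact_mod_cast this
  · intro d hd
    choose m hm using hd
    obtain ⟨m', hm'⟩ := h'.exists_coeff_of_orthogonal v' (x := ∑ k, m k • nullVec P W v k)
      (by rw [← hL]; exact sum_mem fun k _ => zsmul_mem (nullVec_mem_lattice v k) _)
      (by rw [← hv]; exact h.vertex_sum_nullVec v m)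
    apply hp d
    have : n' = fun k => d * m' k := by
      apply h'.eq_of_sum_nullVec_eq v'
      rw [hx]
      have e : ∑ k, n k • nullVec P W v k = d • ∑ k, m k • nullVec P W v k := by
        rw [Finset.smul_sum]
        exact Finset.sum_congr rfl fun k _ => by rw [hm k, mul_smul]
      rw [e, hm', Finset.smul_sum]
      exact Finset.sum_congr rfl fun k _ => by rw [mul_smul]
    intro k
    rw [this]
    exact dvd_mul_right _ _

/-- Adjacent circles have positive curvature sum unless one of them is a line. -/
theorem nullVec_curv_nonneg (h : IsCubeFrame P W) (hP : 0 < P 1) (v : CubeVertex) (k : Fin 3) :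
    0 ≤ nullVec P W v k 1 := by
  have hr := h.curv_rel
  rw [nullVec_eq]
  simp only [vertex, Fin.sum_univ_three, Pi.sub_apply, Pi.smul_apply, Pi.add_apply,
    smul_eq_mul] at hr ⊢
  have aux : ∀ x y z s t : ℝ, P 1 ^ 2 = 2 * (x ^ 2 + y ^ 2 + z ^ 2) → s * s = 1 → t * t = 1 →
      0 ≤ P 1 + s * x + t * y := by
    intro x y z s t he hs ht
    by_contra! hneg
    have : (P 1) ^ 2 < (s * x + t * y) ^ 2 := by nlinarith
    have e : (s * x + t * y) ^ 2 + (s * x - t * y) ^ 2 = 2 * (x ^ 2 + y ^ 2) := by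
      linear_combination 2 * x ^ 2 * hs + 2 * y ^ 2 * ht
    nlinarith [sq_nonneg (s * x - t * y), sq_nonneg z]
  have s0 := boolSign_mul_self (v 0)
  have s1 := boolSign_mul_self (v 1)
  have s2 := boolSign_mul_self (v 2)
  fin_cases k <;> simp
  · linarith [aux (W 1 1) (W 2 1) (W 0 1) _ _ (by linarith) s1 s2]
  · linarith [aux (W 0 1) (W 2 1) (W 1 1) _ _ (by linarith) s0 s2]
  · linarith [aux (W 0 1) (W 1 1) (W 2 1) _ _ (by linarith) s0 s1]

/-- The quadratic relation between the curvatures of a circle and its three neighbours. -/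
theorem curv_quadratic (h : IsCubeFrame P W) (v : CubeVertex) :
    (∑ k, nullVec P W v k 1) ^ 2 - 2 * ∑ k, nullVec P W v k 1 ^ 2 = 8 * vertex P W v 1 ^ 2 := by
  have hr := h.curv_rel
  simp only [nullVec_eq]
  simp only [vertex, Fin.sum_univ_three, Pi.sub_apply, Pi.smul_apply, Pi.add_apply,
    smul_eq_mul] at hr ⊢
  linear_combination 4 * hr - 8 * W 0 1 ^ 2 * boolSign_mul_self (v 0)
    - 8 * W 1 1 ^ 2 * boolSign_mul_self (v 1) - 8 * W 2 1 ^ 2 * boolSign_mul_self (v 2)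

end IsCubeFrame

namespace CubicConfiguration

variable (B : CubicConfiguration)

open IsCubeFrame

/-- If the centre had negative curvature, two disjoint antipodal pairs would each contain a circle
of negative curvature, and the interiors of these two circles would meet near infinity. -/
theorem base_center_curv_pos {P : InversiveSpace} {W : Fin 3 → InversiveSpace}
    (h : IsCubeFrame P W) (hv : ∀ v, (B.base v).vec = vertex P W v) : 0 < P 1 := by
  refine lt_of_le_of_ne ?_ h.center_curv_ne_zero.symm
  by_contra! hP
  have hpair : ∀ v : CubeVertex, (B.base v).curv < 0 ∨ (B.base fun i => !(v i)).curv < 0 := by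
    intro v
    have := congrFun (vertex_add_antipode (P := P) (W := W) v) 1
    rw [← hv, ← hv] at this
    simp only [Pi.add_apply, GenCircle.vec_curv, Pi.smul_apply, smul_eq_mul] at this
    by_contra! hn
    linarith [hn.1, hn.2]
  have hdis : ∀ v w : CubeVertex, v ≠ w → (B.base v).curv < 0 → (B.base w).curv < 0 → False :=
    fun v w hvw h1 h2 => absurd h2 (not_lt.2
      (GenCircle.curv_nonneg_of_disjoint_interior (B.base_interior v w hvw) h1))
  rcases hpair ![true, true, true] with h1 | h1 <;> rcases hpair ![true, true, false] with h2 | h2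
  all_goals
    refine hdis _ _ ?_ h1 h2
    decide

/-- Every octuple is an affine cube with a future-directed centre, and all octuples generate the
same lattice. -/
theorem exists_octuple_frame : ∃ Λ : AddSubgroup InversiveSpace, ∀ o, B.IsOctuple o →
    ∃ P W, IsCubeFrame P W ∧ 0 < P 1 ∧ lattice P W = Λ ∧ ∀ v, (o v).vec = vertex P W v := by
  obtain ⟨P, W, h, hv, hd⟩ := B.exists_base_frame
  refine ⟨lattice P W, ?_⟩
  rintro o ⟨g, hg, ho⟩
  have step : ∀ (F : CubeFace) (o : CubeVertex → GenCircle),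
      (∃ Q V, IsCubeFrame Q V ∧ 0 < Q 1 ∧ lattice Q V = lattice P W ∧
        ∀ v, (o v).vec = vertex Q V v) →
      ∃ Q V, IsCubeFrame Q V ∧ 0 < Q 1 ∧ lattice Q V = lattice P W ∧
        ∀ v, ((B.dual F).reflect (o v)).vec = vertex Q V v := by
    rintro ⟨i, s⟩ o ⟨Q, V, hQ, hpos, hL, ho⟩
    obtain ⟨t, ht, hdt⟩ := hd i s
    have hn := (B.dual (i, s)).lorentz_vec_self
    refine ⟨_, _, hQ.map_reflection hn, hQ.center_reflection_curv_pos hpos hn, ?_, ?_⟩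
    · rw [lattice_map_reflection, hL, h.lattice_map_dual_reflection ht i s hn hdt]
    · intro v
      rw [GenCircle.vec_reflect, ho, vertex_map_reflection]
  have main : ∀ g ∈ B.apollonianGroup, ∃ Q V, IsCubeFrame Q V ∧ 0 < Q 1 ∧
      lattice Q V = lattice P W ∧ ∀ v, (g (B.base v)).vec = vertex Q V v := by
    intro g hg
    induction hg using Subgroup.closure_induction_left with
    | one => exact ⟨P, W, h, B.base_center_curv_pos h hv, rfl, hv⟩
    | mul_left x hx y _ ih =>
      obtain ⟨F, rfl⟩ := hx
      exact step F (fun v => y (B.base v)) ih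
    | inv_mul_cancel x hx y _ ih =>
      obtain ⟨F, rfl⟩ := hx
      exact step F (fun v => y (B.base v)) ih
  simpa only [ho] using main g hg

/-- Induction over the octuples by passing from an octuple to the one reflected in one of its own
dual circles; the two octuples share the four circles on a face. -/
theorem octuple_induction {p : (CubeVertex → GenCircle) → Prop} (h0 : p B.base)
    (hs : ∀ o o', B.IsOctuple o → B.IsOctuple o' → ∀ F : CubeFace,
      (∀ v : CubeVertex, v F.1 = F.2 → o v = o' v) → p o → p o')
    {o : CubeVertex → GenCircle} (ho : B.IsOctuple o) : p o := by
  obtain ⟨g, hg, hgo⟩ := ho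
  have hfix : ∀ (F : CubeFace) (v : CubeVertex), v F.1 = F.2 →
      (B.dual F).reflection (B.base v) = B.base v := fun F v hv =>
    GenCircle.reflect_of_orthogonal (B.incident_orthogonal v F hv)
  obtain rfl : o = fun v => g (B.base v) := funext hgo
  clear hgo
  induction hg using Subgroup.closure_induction_right with
  | one => exact h0
  | mul_right x hx y hy ih =>
    obtain ⟨F, rfl⟩ := hy
    refine hs _ _ ⟨x, hx, fun v => rfl⟩ ⟨x * (B.dual F).reflection, mul_mem hx
      (Subgroup.subset_closure ⟨F, rfl⟩), fun v => rfl⟩ F (fun v hv => ?_) ih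
    rw [Equiv.Perm.mul_apply, hfix F v hv]
  | mul_inv_cancel x hx y hy ih =>
    obtain ⟨F, rfl⟩ := hy
    refine hs _ _ ⟨x, hx, fun v => rfl⟩ ⟨x * ((B.dual F).reflection)⁻¹, mul_mem hx
      (inv_mem (Subgroup.subset_closure ⟨F, rfl⟩)), fun v => rfl⟩ F (fun v hv => ?_) ih
    rw [Equiv.Perm.mul_apply, Equiv.Perm.inv_eq_iff_eq.2 (hfix F v hv).symm]

end CubicConfiguration

/-! ### Represented numbers and the Kronecker symbol -/

/-- Every primitive solution of `n₀n₁ + n₀n₂ + n₁n₂ = 0` comes, up to sign, from the standard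
parametrization of this conic. -/
theorem exists_param_of_conic {n₀ n₁ n₂ : ℤ} (h : n₀ * n₁ + n₀ * n₂ + n₁ * n₂ = 0)
    (hp : ∀ d : ℤ, d ∣ n₀ → d ∣ n₁ → d ∣ n₂ → IsUnit d) :
    ∃ x y ε : ℤ, (ε = 1 ∨ ε = -1) ∧ n₀ = ε * (x ^ 2 - x * y) ∧ n₁ = ε * (y ^ 2 - x * y) ∧
      n₂ = ε * (x * y) := by
  have hsq : (n₀ + n₂) * (n₁ + n₂) = n₂ ^ 2 := by linear_combination h
  have hco : IsCoprime (n₀ + n₂) (n₁ + n₂) := by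
    rw [Int.isCoprime_iff_gcd_eq_one]
    by_contra hg
    obtain ⟨l, hl, hd⟩ := Nat.exists_prime_and_dvd hg
    have hl' := Nat.prime_iff_prime_int.1 hl
    have h1 : (l : ℤ) ∣ n₀ + n₂ := (Int.natCast_dvd_natCast.2 hd).trans (Int.gcd_dvd_left _ _)
    have h2 : (l : ℤ) ∣ n₁ + n₂ := (Int.natCast_dvd_natCast.2 hd).trans (Int.gcd_dvd_right _ _)
    have h3 : (l : ℤ) ∣ n₂ := hl'.dvd_of_dvd_pow (hsq ▸ dvd_mul_of_dvd_left h1 _)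
    exact hl'.not_isUnit (hp l ((dvd_add_left h3).1 h1) ((dvd_add_left h3).1 h2) h3)
  obtain ⟨x, hx⟩ := Int.sq_of_isCoprime hco hsq
  obtain ⟨y, hy⟩ := Int.sq_of_isCoprime hco.symm (by rw [mul_comm]; exact hsq)
  -- the two squares have the same sign, unless one of them vanishes
  obtain ⟨ε, hε, h1, h2⟩ : ∃ ε : ℤ, (ε = 1 ∨ ε = -1) ∧ n₀ + n₂ = ε * x ^ 2 ∧
      n₁ + n₂ = ε * y ^ 2 := by
    have hneg : ∀ u v : ℤ, -(u ^ 2 * v ^ 2) = n₂ ^ 2 → u = 0 ∨ v = 0 := by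
      intro u v e
      have : u ^ 2 * v ^ 2 = 0 := by nlinarith [sq_nonneg (u * v), sq_nonneg n₂]
      simpa using this
    rcases hx with hx | hx <;> rcases hy with hy | hy
    · exact ⟨1, Or.inl rfl, by rw [hx, one_mul], by rw [hy, one_mul]⟩
    · rcases hneg x y (by rw [← hsq, hx, hy]; ring) with h0 | h0
      · exact ⟨-1, Or.inr rfl, by rw [hx, h0]; ring, by rw [hy]; ring⟩
      · exact ⟨1, Or.inl rfl, by rw [hx]; ring, by rw [hy, h0]; ring⟩
    · rcases hneg x y (by rw [← hsq, hx, hy]; ring) with h0 | h0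
      · exact ⟨1, Or.inl rfl, by rw [hx, h0]; ring, by rw [hy]; ring⟩
      · exact ⟨-1, Or.inr rfl, by rw [hx]; ring, by rw [hy, h0]; ring⟩
    · exact ⟨-1, Or.inr rfl, by rw [hx]; ring, by rw [hy]; ring⟩
  have h3 : n₂ ^ 2 = (ε * (x * y)) ^ 2 := by rw [← hsq, h1, h2]; ring
  rcases sq_eq_sq_iff_eq_or_eq_neg.1 h3 with h4 | h4
  · exact ⟨x, y, ε, hε, by linear_combination h1 - h4, by linear_combination h2 - h4, h4⟩
  · exact ⟨x, -y, ε, hε, by linear_combination h1 - h4, by linear_combination h2 - h4, by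
      rw [h4]; ring⟩

theorem isCoprime_of_forall_prime {a b : ℤ}
    (h : ∀ l : ℤ, Prime l → l ∣ a → l ∣ b → False) : IsCoprime a b := by
  rw [Int.isCoprime_iff_gcd_eq_one]
  by_contra hg
  obtain ⟨l, hl, hd⟩ := Nat.exists_prime_and_dvd hg
  exact h l (Nat.prime_iff_prime_int.1 hl)
    ((Int.natCast_dvd_natCast.2 hd).trans (Int.gcd_dvd_left _ _))
    ((Int.natCast_dvd_natCast.2 hd).trans (Int.gcd_dvd_right _ _))

/-- The form `p x² - 2βxy + q y²` properly represents a number coprime to `a`: take for `x` and `y`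
the products of the primes dividing `a` that divide, respectively do not divide, `p`. -/
theorem exists_represented_coprime {a p β q : ℤ} (ha : a ≠ 0)
    (hprim : ∀ l : ℤ, Prime l → l ∣ a → l ∣ p → l ∣ q → False) :
    ∃ x y : ℤ, 0 ≤ y ∧ IsCoprime x y ∧
      IsCoprime (p * x ^ 2 - 2 * β * x * y + q * y ^ 2) a := by
  classical
  obtain ⟨S, hS⟩ : ∃ S, S = a.natAbs.primeFactors.filter fun l : ℕ => (l : ℤ) ∣ p := ⟨_, rfl⟩
  obtain ⟨T, hT⟩ : ∃ T, T = a.natAbs.primeFactors.filter fun l : ℕ => ¬ (l : ℤ) ∣ p := ⟨_, rfl⟩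
  have hmem : ∀ l : ℕ, l.Prime → (l : ℤ) ∣ a → (l ∈ S ↔ (l : ℤ) ∣ p) ∧ (l ∈ T ↔ ¬ (l : ℤ) ∣ p) := by
    intro l hl hla
    have : l ∈ a.natAbs.primeFactors :=
      Nat.mem_primeFactors.2 ⟨hl, Int.natCast_dvd.1 hla, Int.natAbs_ne_zero.2 ha⟩
    simp [hS, hT, this]
  have hSp : ∀ l ∈ S, l.Prime := fun l hl => Nat.prime_of_mem_primeFactors
    (Finset.mem_filter.1 (hS ▸ hl)).1
  have hTp : ∀ l ∈ T, l.Prime := fun l hl => Nat.prime_of_mem_primeFactors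
    (Finset.mem_filter.1 (hT ▸ hl)).1
  have hdvd : ∀ (U : Finset ℕ), (∀ l ∈ U, l.Prime) → ∀ l : ℕ, l.Prime →
      ((l : ℤ) ∣ ∏ i ∈ U, (i : ℤ) ↔ l ∈ U) := by
    intro U hU l hl
    constructor
    · intro h
      obtain ⟨i, hi, hd⟩ := (Nat.prime_iff_prime_int.1 hl).exists_mem_finset_dvd h
      rwa [(Nat.prime_dvd_prime_iff_eq hl (hU i hi)).1 (Int.natCast_dvd_natCast.1 hd)]
    · exact fun h => Finset.dvd_prod_of_mem _ h
  refine ⟨∏ i ∈ S, (i : ℤ), ∏ i ∈ T, (i : ℤ), Finset.prod_nonneg fun i _ => by positivity, ?_, ?_⟩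
  · refine IsCoprime.prod_left fun i hi => IsCoprime.prod_right fun j hj => ?_
    rw [Nat.isCoprime_iff_coprime, Nat.coprime_primes (hSp i hi) (hTp j hj)]
    rintro rfl
    rw [hS] at hi
    rw [hT] at hj
    exact (Finset.mem_filter.1 hj).2 (Finset.mem_filter.1 hi).2
  · rw [Int.isCoprime_iff_gcd_eq_one]
    by_contra hg
    obtain ⟨l, hl, hd⟩ := Nat.exists_prime_and_dvd hg
    have hl' := Nat.prime_iff_prime_int.1 hl
    have h1 := (Int.natCast_dvd_natCast.2 hd).trans (Int.gcd_dvd_left _ _)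
    have h2 : (l : ℤ) ∣ a := (Int.natCast_dvd_natCast.2 hd).trans (Int.gcd_dvd_right _ _)
    obtain ⟨m1, m2⟩ := hmem l hl h2
    by_cases hlp : (l : ℤ) ∣ p
    · have hx := (hdvd S hSp l hl).2 (m1.2 hlp)
      have hy : ¬ (l : ℤ) ∣ ∏ i ∈ T, (i : ℤ) := by
        rw [hdvd T hTp l hl, m2]; exact fun h => h hlp
      have h3 : (l : ℤ) ∣ q * (∏ i ∈ T, (i : ℤ)) ^ 2 := by
        refine (dvd_add_right (dvd_sub ?_ ?_)).1 h1
        · exact dvd_mul_of_dvd_left hlp _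
        · exact dvd_mul_of_dvd_left (dvd_mul_of_dvd_right hx _) _
      rcases hl'.dvd_or_dvd h3 with h4 | h4
      · exact hprim l hl' h2 hlp h4
      · exact hy (hl'.dvd_of_dvd_pow h4)
    · have hy := (hdvd T hTp l hl).2 (m2.2 hlp)
      have hx : ¬ (l : ℤ) ∣ ∏ i ∈ S, (i : ℤ) := by
        rw [hdvd S hSp l hl, m1]; exact hlp
      have h3 : (l : ℤ) ∣ p * (∏ i ∈ S, (i : ℤ)) ^ 2 := by
        have h4 : (l : ℤ) ∣ 2 * β * (∏ i ∈ S, (i : ℤ)) * ∏ i ∈ T, (i : ℤ) :=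
          dvd_mul_of_dvd_right hy _
        have h5 : (l : ℤ) ∣ q * (∏ i ∈ T, (i : ℤ)) ^ 2 :=
          dvd_mul_of_dvd_right (dvd_pow hy two_ne_zero) _
        exact (dvd_sub_left h4).1 ((dvd_add_left h5).1 h1)
      rcases hl'.dvd_or_dvd h3 with h4 | h4
      · exact hlp h4
      · exact hx (hl'.dvd_of_dvd_pow h4)

/-- Removal of the common factor `s` of `a`, `p` and `β`. -/
theorem exists_reduced_form {a p β q : ℤ} (ha : a ≠ 0) (hpq : p * q = β ^ 2 + 2 * a ^ 2)
    (hprim : ∀ l : ℤ, Prime l → l ∣ a → l ∣ p → l ∣ q → False) :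
    ∃ (s : ℕ) (a₁ p₁ β₁ : ℤ), 0 < s ∧ a = s * a₁ ∧ p = s ^ 2 * p₁ ∧ β = s * β₁ ∧
      p₁ * q = β₁ ^ 2 + 2 * a₁ ^ 2 ∧ IsCoprime a₁ p₁ := by
  obtain ⟨s, hs⟩ : ∃ s : ℕ, s = Int.gcd (Int.gcd a p) β := ⟨_, rfl⟩
  have hs1 : (s : ℤ) ∣ Int.gcd a p := by rw [hs]; exact Int.gcd_dvd_left _ _
  have hsa : (s : ℤ) ∣ a := hs1.trans (Int.gcd_dvd_left _ _)
  have hsp : (s : ℤ) ∣ p := hs1.trans (Int.gcd_dvd_right _ _)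
  have hsβ : (s : ℤ) ∣ β := by rw [hs]; exact Int.gcd_dvd_right _ _
  have hs0 : 0 < s := by
    rcases Nat.eq_zero_or_pos s with h | h
    · rw [h] at hsa; exact absurd (by simpa using hsa) ha
    · exact h
  have hs0' : (s : ℤ) ≠ 0 := by exact_mod_cast hs0.ne'
  have hsq : IsCoprime ((s : ℤ) ^ 2) q := IsCoprime.pow_left (isCoprime_of_forall_prime
    fun l hl h1 h2 => hprim l hl (h1.trans hsa) (h1.trans hsp) h2)
  obtain ⟨a₁, ha₁⟩ := hsa
  obtain ⟨β₁, hβ₁⟩ := hsβ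
  obtain ⟨p₁, hp₁⟩ : (s : ℤ) ^ 2 ∣ p := by
    refine hsq.dvd_of_dvd_mul_right (hpq ▸ ⟨β₁ ^ 2 + 2 * a₁ ^ 2, ?_⟩)
    rw [ha₁, hβ₁]; ring
  have hred : p₁ * q = β₁ ^ 2 + 2 * a₁ ^ 2 := by
    apply mul_left_cancel₀ (pow_ne_zero 2 hs0')
    rw [ha₁, hβ₁, hp₁] at hpq
    linear_combination hpq
  refine ⟨s, a₁, p₁, β₁, hs0, ha₁, hp₁, hβ₁, hred, isCoprime_of_forall_prime ?_⟩
  intro l hl h1 h2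
  have h3 : l ∣ β₁ := by
    refine hl.dvd_of_dvd_pow (n := 2) ?_
    rw [show β₁ ^ 2 = p₁ * q - 2 * a₁ ^ 2 by linarith]
    exact dvd_sub (dvd_mul_of_dvd_left h2 _) (dvd_mul_of_dvd_right (dvd_pow h1 two_ne_zero) _)
  -- now `s * l` is a common divisor of `a`, `p` and `β`
  have h4 : (s : ℤ) * l ∣ s := by
    nth_rewrite 2 [hs]
    refine Int.dvd_coe_gcd (Int.dvd_coe_gcd ?_ ?_) ?_
    · rw [ha₁]; exact mul_dvd_mul_left _ h1
    · rw [hp₁, pow_two, mul_assoc]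
      exact mul_dvd_mul_left _ (dvd_mul_of_dvd_right h2 _)
    · rw [hβ₁]; exact mul_dvd_mul_left _ h3
  exact hl.not_isUnit (isUnit_of_dvd_one ((mul_dvd_mul_iff_left hs0').1 (by simpa using h4)))

theorem gcd_eq_one_of_isCoprime_natCast {a : ℤ} {n : ℕ} (h : IsCoprime a n) :
    a.gcd n = 1 := Int.isCoprime_iff_gcd_eq_one.1 h

theorem jacobiSym_congr {a b : ℤ} {n : ℕ} (h : (n : ℤ) ∣ a - b) : J(a | n) = J(b | n) :=
  jacobiSym.mod_left' (Int.modEq_iff_dvd.2 h).symm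

theorem jacobiSym_mul_self {a : ℤ} {n : ℕ} (h : IsCoprime a n) : J(a | n) * J(a | n) = 1 := by
  rw [← pow_two, jacobiSym.sq_one (gcd_eq_one_of_isCoprime_natCast h)]

/-- The genus characters at the odd primes dividing `a`: at a prime dividing `s` the symbol of a
represented number is that of `q`, elsewhere it is that of `p₁`. -/
theorem jacobiSym_of_represented {s m : ℕ} {a₁ p₁ β₁ q x y ρ : ℤ} (hs : s ≠ 0) (hm : m ≠ 0)
    (hred : p₁ * q = β₁ ^ 2 + 2 * a₁ ^ 2) (hma : (m : ℤ) ∣ a₁) (hco : IsCoprime a₁ p₁)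
    (hρ : ρ = s ^ 2 * p₁ * x ^ 2 - 2 * (s * β₁) * x * y + q * y ^ 2)
    (hρs : IsCoprime ρ s) (hρm : IsCoprime ρ m) :
    J(ρ | s * m) = J(q | s) * J(p₁ | m) ∧ J(q | s) * J(q | s) = 1 := by
  have h1 : J(ρ | s) = J(q | s) * (J(y | s) * J(y | s)) := by
    rw [← jacobiSym.mul_left, ← jacobiSym.mul_left]
    exact jacobiSym_congr ⟨s * p₁ * x ^ 2 - 2 * β₁ * x * y, by rw [hρ]; ring⟩
  have hqy : IsCoprime (q * (y * y)) s := by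
    have : q * (y * y) = ρ + s * (-(s * p₁ * x ^ 2 - 2 * β₁ * x * y)) := by rw [hρ]; ring
    rw [this]
    exact hρs.add_mul_left_left _
  have hy : IsCoprime y s := hqy.of_mul_left_right.of_mul_left_right
  have hq : IsCoprime q s := hqy.of_mul_left_left
  rw [jacobiSym_mul_self hy, mul_one] at h1
  have hpm : IsCoprime p₁ m := (hco.of_isCoprime_of_dvd_left hma).symm
  have h2 : J(p₁ * ρ | m) = 1 := by
    have hT : p₁ * ρ = (s * p₁ * x - β₁ * y) ^ 2 + 2 * a₁ ^ 2 * y ^ 2 := by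
      rw [hρ]; linear_combination y ^ 2 * hred
    obtain ⟨c, hc⟩ := hma
    have hd : p₁ * ρ - (s * p₁ * x - β₁ * y) ^ 2 = m * (2 * c * a₁ * y ^ 2) := by
      rw [hT, hc]; ring
    have hcT : IsCoprime ((s * p₁ * x - β₁ * y) ^ 2) m := by
      rw [show (s * p₁ * x - β₁ * y) ^ 2 = p₁ * ρ + m * (-(2 * c * a₁ * y ^ 2)) by linarith]
      exact (hpm.mul_left hρm).add_mul_left_left _
    rw [jacobiSym_congr ⟨_, hd⟩]
    exact jacobiSym.sq_one' (gcd_eq_one_of_isCoprime_natCast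
      ((IsCoprime.pow_left_iff two_pos).1 hcT))
  have h3 : J(ρ | m) = J(p₁ | m) := by
    rw [jacobiSym.mul_left] at h2
    linear_combination J(p₁ | m) * h2 - J(ρ | m) * jacobiSym_mul_self hpm
  refine ⟨?_, jacobiSym_mul_self hq⟩
  rw [jacobiSym.mul_right' ρ hs hm, h1, h3]

/-- Since the discriminant `-8a²` is a square modulo `p₁`, so is `-2`. -/
theorem jacobiSym_neg_two {P : ℕ} {a₁ β₁ q : ℤ} (hP : Odd P)
    (hred : P * q = β₁ ^ 2 + 2 * a₁ ^ 2) (hco : IsCoprime a₁ P) : J(-2 | P) = 1 := by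
  have h2 : IsCoprime (-2 : ℤ) P := by
    rw [IsCoprime.neg_left_iff]
    exact_mod_cast (Nat.isCoprime_iff_coprime (m := 2)).2 hP.coprime_two_left
  have h1 : J(-2 * (a₁ * a₁) | P) = J(β₁ ^ 2 | P) :=
    jacobiSym_congr ⟨-q, by linear_combination hred⟩
  have hβ : IsCoprime (β₁ ^ 2) P := by
    rw [show β₁ ^ 2 = -2 * (a₁ * a₁) + P * q by linear_combination -hred]
    exact (h2.mul_left (hco.mul_left hco)).add_mul_left_left _
  rw [jacobiSym.sq_one' (gcd_eq_one_of_isCoprime_natCast ((IsCoprime.pow_left_iff two_pos).1 hβ)),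
    jacobiSym.mul_left, jacobiSym.mul_left, jacobiSym_mul_self hco, mul_one] at h1
  exact h1

theorem mod_eight_of_jacobiSym_neg_two {P : ℕ} (hP : Odd P) (h : J(-2 | P) = 1) :
    P % 8 = 1 ∨ P % 8 = 3 := by
  rw [jacobiSym.at_neg_two hP, ZMod.χ₈'_nat_eq_if_mod_eight] at h
  have := Nat.odd_iff.1 hP
  split_ifs at h with h1 h2
  · omega
  · exact h2

theorem kroneckerSymbol_eq {a b : ℤ} {k m : ℕ} (hb : b.natAbs = 2 ^ k * m) (hm : Odd m) :
    kroneckerSymbol a b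
      = (if b < 0 ∧ a < 0 then -1 else 1) * ZMod.χ₈ (a : ZMod 8) ^ k * J(a | m) := by
  have hk : padicValNat 2 b.natAbs = k := by
    rw [hb, padicValNat.mul (by positivity) (by rintro rfl; simp at hm),
      padicValNat.prime_pow, padicValNat.eq_zero_of_not_dvd (by
        rw [← even_iff_two_dvd, Nat.not_even_iff_odd]; exact hm), add_zero]
  rw [kroneckerSymbol, hk, hb, Nat.mul_div_cancel_left _ (by positivity)]

theorem kroneckerSymbol_of_odd {a b : ℤ} (ha : 0 < a) (hb : Odd b) :
    kroneckerSymbol a b = J(a | b.natAbs) := by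
  rw [kroneckerSymbol_eq (k := 0) (by rw [pow_zero, one_mul]) (Int.natAbs_odd.2 hb),
    if_neg (fun h => absurd h.2 (not_lt.2 ha.le))]
  simp

/-! ### Reciprocity between adjacent circles -/

/-- Quadratic reciprocity with the sign absorbed: if `N = ±n` is congruent to `1` modulo `4`, then
`(P / n) = (N / P)`. -/
theorem jacobiSym_natAbs {P : ℕ} {N : ℤ} (hP : Odd P) (hN : N % 4 = 1) :
    J(P | N.natAbs) = J(N | P) := by
  rcases lt_or_ge N 0 with h | h
  · have hn : N.natAbs % 4 = 3 := by omega
    have hNn : N = -(N.natAbs : ℤ) := by omega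
    have e : J(N | P) = ZMod.χ₄ P * J((N.natAbs : ℤ) | P) := by
      rw [← jacobiSym.neg _ hP, ← hNn]
    rw [e]
    rcases Nat.odd_mod_four_iff.1 (Nat.odd_iff.1 hP) with h4 | h4
    · rw [ZMod.χ₄_nat_one_mod_four h4, one_mul]
      exact jacobiSym.quadratic_reciprocity_one_mod_four h4 (Nat.odd_iff.2 (by omega))
    · rw [ZMod.χ₄_nat_three_mod_four h4, jacobiSym.quadratic_reciprocity_three_mod_four h4 hn]
      ring
  · have hNn : N = (N.natAbs : ℤ) := by omega
    conv_rhs => rw [hNn]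
    exact jacobiSym.quadratic_reciprocity_one_mod_four' hP (by omega)

theorem sq_mod_eight_of_odd {s : ℤ} (hs : Odd s) : ∃ k, s ^ 2 = 8 * k + 1 := by
  obtain ⟨m, rfl⟩ := hs
  rcases Int.even_or_odd' m with ⟨c, rfl | rfl⟩
  · exact ⟨c * (2 * c + 1), by ring⟩
  · exact ⟨(2 * c + 1) * (c + 1), by ring⟩

theorem chi8_natAbs {N : ℤ} (hN : Odd N) :
    ZMod.χ₈ (N.natAbs : ZMod 8) = if N % 8 = 1 ∨ N % 8 = 7 then 1 else -1 := by
  rw [ZMod.χ₈_nat_eq_if_mod_eight]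
  have := Int.odd_iff.1 hN
  split_ifs <;> omega

theorem jacobiSym_mul_mul_self {P : ℕ} {a c : ℤ} (h : IsCoprime a P) :
    J(c * (a * a) | P) = J(c | P) := by
  rw [jacobiSym.mul_left, jacobiSym.mul_left, jacobiSym_mul_self h, mul_one]

/-- The reciprocity step for two adjacent circles of odd curvature: `a₁ b₁ ≡ -a₁²` modulo `P`, so
`(a₁ b₁ / P) = (-1 / P)`, and the supplementary law at `2` supplies the rest. -/
theorem jacobiSym_mul_of_odd_odd {s P : ℕ} {a b a₁ b₁ : ℤ} (ha : a = s * a₁) (hb : b = s * b₁)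
    (ha4 : a % 4 = 3) (hb4 : b % 4 = 3) (hab : a₁ + b₁ = s * (2 * P)) (hP : Odd P)
    (hco : IsCoprime a₁ P) :
    J(2 * P | a₁.natAbs) * J(2 * P | b₁.natAbs) = -1 := by
  have hao : Odd a := Int.odd_iff.2 (by omega)
  have hbo : Odd b := Int.odd_iff.2 (by omega)
  have hs : Odd (s : ℤ) := (Int.odd_mul.1 (ha ▸ hao)).1
  have hao₁ : Odd a₁ := (Int.odd_mul.1 (ha ▸ hao)).2
  have hbo₁ : Odd b₁ := (Int.odd_mul.1 (hb ▸ hbo)).2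
  obtain ⟨k, hk⟩ := sq_mod_eight_of_odd hs
  have hprod : a * b = 8 * (k * (a₁ * b₁)) + a₁ * b₁ := by
    rw [ha, hb]; linear_combination a₁ * b₁ * hk
  have hsum : a + b = 16 * (k * P) + 2 * P := by
    rw [ha, hb]; linear_combination (s : ℤ) * hab + 2 * P * hk
  have hP4 : (P : ℤ) % 2 = 1 := by exact_mod_cast Nat.odd_iff.1 hP
  have hN4 : (a₁ * b₁) % 4 = 1 := by
    have : (a * b) % 4 = 1 := by rw [Int.mul_emod, ha4, hb4]; rfl
    omega
  have hNP : J(a₁ * b₁ | P) = ZMod.χ₄ P := by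
    rw [jacobiSym_congr (b := -1 * (a₁ * a₁)) ⟨a₁ * s * 2, by linear_combination a₁ * hab⟩,
      jacobiSym_mul_mul_self hco, jacobiSym.at_neg_one hP]
  rw [← jacobiSym.mul_right' _ (Int.natAbs_ne_zero.2 (by rintro rfl; simp at hao₁))
    (Int.natAbs_ne_zero.2 (by rintro rfl; simp at hbo₁)), ← Int.natAbs_mul, jacobiSym.mul_left,
    jacobiSym_natAbs hP hN4, hNP, jacobiSym.at_two (Int.natAbs_odd.2 (hao₁.mul hbo₁)),
    chi8_natAbs (hao₁.mul hbo₁)]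
  -- the residues of `a` and `b` modulo `8` decide both `a₁ b₁` modulo `8` and `P` modulo `4`
  have h8 : (a * b) % 8 = (a % 8) * (b % 8) % 8 := Int.mul_emod _ _ _
  have ha8 : a % 8 = 3 ∨ a % 8 = 7 := by omega
  have hb8 : b % 8 = 3 ∨ b % 8 = 7 := by omega
  have hcase : ((a₁ * b₁) % 8 = 1 ∧ P % 4 = 3) ∨
      ((a₁ * b₁) % 8 = 5 ∧ P % 4 = 1) := by
    rcases ha8 with h1 | h1 <;> rcases hb8 with h2 | h2 <;> rw [h1, h2] at h8 <;> omega
  rcases hcase with ⟨h1, h2⟩ | ⟨h1, h2⟩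
  · rw [if_pos (Or.inl h1), ZMod.χ₄_nat_three_mod_four h2, one_mul]
  · rw [if_neg (by omega), ZMod.χ₄_nat_one_mod_four h2, mul_one]

/-- The reciprocity step for two adjacent circles of curvatures `2^k s m`, with `m` odd, and
`s b₁ ≡ 3` modulo `4`, where `s P` is the sum of `2^k m` and `b₁`. -/
theorem jacobiSym_mul_of_even_odd {s P k : ℕ} {b m b₁ : ℤ} (hb : b = s * b₁) (hm : Odd m)
    (hb4 : b % 4 = 3) (hab : 2 ^ k * m + b₁ = s * P) (hP : Odd P) (hco : IsCoprime m P) :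
    J(P | m.natAbs) * J(P | b₁.natAbs)
      = J(2 | P) ^ k * (if P % 4 = 3 ∧ (m * b₁) % 4 = 1 then -1 else 1) := by
  have hbo : Odd b := Int.odd_iff.2 (by omega)
  have hbo₁ : Odd b₁ := (Int.odd_mul.1 (hb ▸ hbo)).2
  have h2P : IsCoprime (2 : ℤ) P := by
    exact_mod_cast (Nat.isCoprime_iff_coprime (m := 2)).2 hP.coprime_two_left
  have hmb := hm.mul hbo₁
  have hJ : J(m * b₁ | P) = J(-1 | P) * J(2 | P) ^ k := by
    have : m * b₁ - -1 * 2 ^ k * (m * m) = P * (m * s) := by linear_combination m * hab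
    rw [jacobiSym_congr ⟨_, this⟩, jacobiSym_mul_mul_self hco, jacobiSym.mul_left,
      jacobiSym.pow_left]
  rw [← jacobiSym.mul_right' _ (Int.natAbs_ne_zero.2 (by rintro rfl; simp at hm))
    (Int.natAbs_ne_zero.2 (by rintro rfl; simp at hbo₁)), ← Int.natAbs_mul]
  have hodd := Int.odd_iff.1 hmb
  have hPodd := Nat.odd_iff.1 hP
  rw [jacobiSym.at_neg_one hP] at hJ
  rcases (by omega : (m * b₁) % 4 = 1 ∨ (m * b₁) % 4 = 3) with h4 | h4
  · rw [jacobiSym_natAbs hP h4, hJ]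
    rcases Nat.odd_mod_four_iff.1 hPodd with h1 | h1
    · rw [ZMod.χ₄_nat_one_mod_four h1, if_neg (by omega)]; ring
    · rw [ZMod.χ₄_nat_three_mod_four h1, if_pos ⟨h1, h4⟩]; ring
  · have h4' : (-(m * b₁)) % 4 = 1 := by omega
    rw [← Int.natAbs_neg, jacobiSym_natAbs hP h4', jacobiSym.neg _ hP, hJ, if_neg (by omega)]
    rcases Nat.odd_mod_four_iff.1 hPodd with h1 | h1
    · rw [ZMod.χ₄_nat_one_mod_four h1]; ring
    · rw [ZMod.χ₄_nat_three_mod_four h1]; ring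

/-- The hypotheses of the arithmetic part, for two adjacent circles of curvatures `a` and `b` with
`p = a + b`: the quadratic forms of the two circles are `p x² - 2βxy + q y²` and
`p x² - 2βxy + (q + 2b - 2a) y²`. -/
structure AdjacentForms (a b p β q : ℤ) : Prop where
  sum_eq : p = a + b
  sum_pos : 0 < p
  left_ne : a ≠ 0
  disc_eq : p * q = β ^ 2 + 2 * a ^ 2
  primitive : ∀ l : ℤ, Prime l → l ∣ a → l ∣ p → l ∣ q → False

/-- If `4` divides `a`, every number represented by the form and prime to `a` is `3` modulo `8`. -/
theorem AdjacentForms.mod_eight {a b p β q x y ρ : ℤ} (h : AdjacentForms a b p β q)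
    (ha4 : a % 4 = 0) (hb4 : b % 4 = 3)
    (hρ : ρ = p * x ^ 2 - 2 * β * x * y + q * y ^ 2) (hco : IsCoprime ρ a) : ρ % 8 = 3 := by
  obtain ⟨s, a₁, p₁, β₁, hs, ha, hp, hβ, hred, hc⟩ :=
    exists_reduced_form h.left_ne h.disc_eq h.primitive
  have hsum := h.sum_eq
  have hpo : Odd p := Int.odd_iff.2 (by omega)
  have hp₁o : Odd p₁ := (Int.odd_mul.1 (hp ▸ hpo)).2
  have hso : Odd (s : ℤ) := by
    have := (Int.odd_mul.1 (hp ▸ hpo)).1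
    exact Int.Odd.of_mul_left (pow_two (s : ℤ) ▸ this)
  have hp₁ : 0 < p₁ := by
    have := h.sum_pos
    rw [hp] at this
    exact pos_of_mul_pos_right this (by positivity)
  lift p₁ to ℕ using hp₁.le with P
  have hP : Odd P := by exact_mod_cast hp₁o
  have hJ := mod_eight_of_jacobiSym_neg_two hP (jacobiSym_neg_two hP hred hc)
  obtain ⟨k, hk⟩ := sq_mod_eight_of_odd hso
  have hp8 : p = 8 * (k * P) + P := by rw [hp, hk]; ring
  have hP8 : p % 8 = 3 := by omega
  have hρo : Odd ρ := by
    rw [← Int.not_even_iff_odd]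
    intro he
    have h2 : (2 : ℤ) ∣ a := by omega
    have := hco.isUnit_of_dvd' he.two_dvd h2
    exact absurd this (by decide)
  have hT : p * ρ = (p * x - β * y) ^ 2 + 2 * a ^ 2 * y ^ 2 := by
    rw [hρ]; linear_combination y ^ 2 * h.disc_eq
  obtain ⟨c, hc4⟩ : (4 : ℤ) ∣ a := Int.dvd_of_emod_eq_zero ha4
  have hTo : Odd (p * x - β * y) := by
    have h1 : Odd ((p * x - β * y) ^ 2) := by
      rw [show (p * x - β * y) ^ 2 = p * ρ - 2 * (a ^ 2 * y ^ 2) by linarith]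
      exact (hpo.mul hρo).sub_even (even_two_mul _)
    exact (Int.odd_pow.1 h1).resolve_right two_ne_zero
  obtain ⟨j, hj⟩ := sq_mod_eight_of_odd hTo
  have h1 : (p * ρ) % 8 = 1 := by
    rw [hT, hj, hc4, show 8 * j + 1 + 2 * (4 * c) ^ 2 * y ^ 2 = 1 + 8 * (j + 4 * c ^ 2 * y ^ 2) by
      ring]
    omega
  have h2 : (p * ρ) % 8 = 3 * (ρ % 8) % 8 := by rw [Int.mul_emod, hP8]
  omega

theorem natAbs_natCast_mul (s : ℕ) (a : ℤ) : ((s : ℤ) * a).natAbs = s * a.natAbs := by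
  rw [Int.natAbs_mul, Int.natAbs_natCast]

/-- The values of `χ₂` at two adjacent circles, the second of odd curvature, are opposite. The
curvatures may have a common factor `s`; its contributions `(q / s)` to the two values cancel, and
what remains is reciprocity between the cofactors `a₁` and `b₁`, whose sum is `s p₁`. -/
theorem AdjacentForms.chi2Value_mul {a b p β q q' x y x' y' ρ ρ' : ℤ}
    (h : AdjacentForms a b p β q) (hb4 : b % 4 = 3) (ha4 : a % 4 ≠ 1)
    (hq' : q' = q + 2 * b - 2 * a)
    (hρ : ρ = p * x ^ 2 - 2 * β * x * y + q * y ^ 2)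
    (hρ' : ρ' = p * x' ^ 2 - 2 * β * x' * y' + q' * y' ^ 2)
    (hpos : 0 < ρ) (hpos' : 0 < ρ') (hco : IsCoprime ρ a) (hco' : IsCoprime ρ' b) :
    chi2Value a ρ * chi2Value b ρ' = -1 := by
  obtain ⟨s, a₁, p₁, β₁, hs, ha, hp, hβ, hred, hc⟩ :=
    exists_reduced_form h.left_ne h.disc_eq h.primitive
  have hs0 : s ≠ 0 := hs.ne'
  have hsum := h.sum_eq
  have hp₁ : 0 < p₁ := by
    have := h.sum_pos
    rw [hp] at this
    exact pos_of_mul_pos_right this (by positivity)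
  obtain ⟨b₁, hb₁⟩ : ∃ b₁, b₁ = s * p₁ - a₁ := ⟨_, rfl⟩
  have hb : b = s * b₁ := by rw [hb₁]; linear_combination -hsum + hp - ha
  have hsum₁ : a₁ + b₁ = s * p₁ := by rw [hb₁]; ring
  have hbo : Odd b := Int.odd_iff.2 (by omega)
  have hso : Odd (s : ℤ) := (Int.odd_mul.1 (hb ▸ hbo)).1
  have hbo₁ : Odd b₁ := (Int.odd_mul.1 (hb ▸ hbo)).2
  have hb₁0 : b₁.natAbs ≠ 0 := Int.natAbs_ne_zero.2 (by rintro rfl; simp at hbo₁)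
  have hred' : p₁ * q' = β₁ ^ 2 + 2 * b₁ ^ 2 := by
    rw [hq', hb₁]
    linear_combination hred + 2 * p₁ * (hb - ha) + 2 * s * p₁ * hb₁
  have hcb : IsCoprime b₁ p₁ := by
    rw [hb₁, show s * p₁ - a₁ = -a₁ + p₁ * s by ring]
    exact hc.neg_left.add_mul_left_left _
  have hbabs : b.natAbs = s * b₁.natAbs := by rw [hb, natAbs_natCast_mul]
  -- the value at `b`
  have hχb : chi2Value b ρ' = J(q | s) * J(p₁ | b₁.natAbs) := by
    have hcs : IsCoprime ρ' (s * b₁) := hb ▸ hco'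
    obtain ⟨e, -⟩ := jacobiSym_of_represented (m := b₁.natAbs) hs0 hb₁0 hred'
      (Int.natAbs_dvd.2 dvd_rfl) hcb (by rw [hρ', hp, hβ]) hcs.of_mul_right_left
      (hcs.of_mul_right_right.of_isCoprime_of_dvd_right (Int.natAbs_dvd.2 dvd_rfl))
    rw [chi2Value, if_pos hb4, kroneckerSymbol_of_odd hpos' hbo, hbabs, e]
    congr 1
    refine jacobiSym_congr ⟨2 * b₁ - 2 * a₁, ?_⟩
    rw [hq']; linear_combination 2 * hb - 2 * ha
  have hcs : IsCoprime ρ (s * a₁) := ha ▸ hco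
  rcases (by omega : a % 4 = 3 ∨ a % 4 = 2 ∨ a % 4 = 0) with h4 | h4 | h4
  · -- `a` odd: `p₁ = 2 P` with `P` odd
    have hao : Odd a := Int.odd_iff.2 (by omega)
    have hao₁ : Odd a₁ := (Int.odd_mul.1 (ha ▸ hao)).2
    have ha₁0 : a₁.natAbs ≠ 0 := Int.natAbs_ne_zero.2 (by rintro rfl; simp at hao₁)
    obtain ⟨e, hqq⟩ := jacobiSym_of_represented (m := a₁.natAbs) hs0 ha₁0 hred
      (Int.natAbs_dvd.2 dvd_rfl) hc (by rw [hρ, hp, hβ]) hcs.of_mul_right_left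
      (hcs.of_mul_right_right.of_isCoprime_of_dvd_right (Int.natAbs_dvd.2 dvd_rfl))
    obtain ⟨k, hk⟩ := sq_mod_eight_of_odd hso
    have hp8 : p = 8 * (k * p₁) + p₁ := by rw [hp, hk]; ring
    obtain ⟨P, rfl⟩ : ∃ P : ℕ, p₁ = 2 * P := ⟨(p₁ / 2).toNat, by omega⟩
    have hP : Odd P := Nat.odd_iff.2 (by omega)
    have key := jacobiSym_mul_of_odd_odd ha hb h4 hb4 hsum₁ hP hc.of_mul_right_right
    rw [hχb, chi2Value, if_pos h4, kroneckerSymbol_of_odd hpos hao, ha, natAbs_natCast_mul, e]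
    linear_combination J(q | s) * J(q | s) * key - hqq
  all_goals
    have hpo : Odd p := Int.odd_iff.2 (by omega)
    have hp₁o : Odd p₁ := (Int.odd_mul.1 (hp ▸ hpo)).2
    obtain ⟨j, hj⟩ := sq_mod_eight_of_odd hso
    have hp8 : p = 8 * (j * p₁) + p₁ := by rw [hp, hj]; ring
    lift p₁ to ℕ using hp₁.le with P
    have hP : Odd P := by exact_mod_cast hp₁o
    have hP8 := mod_eight_of_jacobiSym_neg_two hP (jacobiSym_neg_two hP hred hc)
    have ha₁n : a₁ ≠ 0 := by rintro rfl; exact h.left_ne (by rw [ha, mul_zero])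
    obtain ⟨k, m, hm, ham⟩ : ∃ (k : ℕ) (m : ℤ), Odd m ∧ a₁ = 2 ^ k * m := by
      obtain ⟨m, hk, hm⟩ := FiniteMultiplicity.exists_eq_pow_mul_and_not_dvd
        (Int.finiteMultiplicity_iff.2 ⟨by decide, ha₁n⟩ : FiniteMultiplicity 2 a₁)
      exact ⟨_, m, by rwa [← Int.not_even_iff_odd, even_iff_two_dvd], hk⟩
    have hm0 : m.natAbs ≠ 0 := Int.natAbs_ne_zero.2 (by rintro rfl; simp at hm)
    have hcm : IsCoprime m P := (ham ▸ hc).of_mul_left_right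
    have hma : (m.natAbs : ℤ) ∣ a₁ := by rw [ham]; exact Int.natAbs_dvd.2 (dvd_mul_left _ _)
    obtain ⟨e, hqq⟩ := jacobiSym_of_represented (m := m.natAbs) hs0 hm0 hred
      hma hc (by rw [hρ, hp, hβ]) hcs.of_mul_right_left
      (hcs.of_mul_right_right.of_isCoprime_of_dvd_right hma)
    have key := jacobiSym_mul_of_even_odd hb hm hb4 (ham ▸ hsum₁) hP hcm
    have hab2 : a = 2 ^ k * (s * m) := by rw [ha, ham]; ring
    have hsm : Odd ((s : ℤ) * m) := hso.mul hm
    have hsm2 := Int.odd_iff.1 hsm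
    have hk0 : k ≠ 0 := by
      rintro rfl
      rw [pow_zero, one_mul] at hab2
      omega
  · -- `a ≡ 2` modulo `4`
    have hk1 : k = 1 := by
      by_contra hk1
      obtain ⟨i, rfl⟩ := Nat.exists_eq_add_of_le (show 2 ≤ k by omega)
      rw [pow_add, mul_assoc] at hab2
      omega
    subst hk1
    have hP1 : P % 8 = 1 := by omega
    have h2P : J(2 | P) = 1 := by
      rw [jacobiSym.at_two hP, ZMod.χ₈_nat_eq_if_mod_eight, if_neg (by omega),
        if_pos (Or.inl hP1)]
    rw [h2P, if_neg (by omega)] at key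
    have hadiv : a / 2 = s * m := by omega
    rw [hχb, chi2Value, if_neg (by omega), if_neg (by omega), if_pos h4, hadiv,
      kroneckerSymbol_of_odd hpos hsm, natAbs_natCast_mul, e]
    linear_combination -J(q | s) * J(q | s) * key - hqq
  · -- `a ≡ 0` modulo `4`
    have hP3 : P % 8 = 3 := by omega
    have hρ8 := h.mod_eight h4 hb4 hρ hco
    have h2P : J(2 | P) = -1 := by
      rw [jacobiSym.at_two hP, ZMod.χ₈_nat_eq_if_mod_eight, if_neg (by omega), if_neg (by omega)]
    have hχ8 : ZMod.χ₈ ((-ρ : ℤ) : ZMod 8) = -1 := by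
      rw [ZMod.χ₈_int_eq_if_mod_eight, if_neg (by omega), if_neg (by omega)]
    have habs : a.natAbs = 2 ^ k * (s * m.natAbs) := by
      rw [hab2, Int.natAbs_mul, natAbs_natCast_mul, Int.natAbs_pow]; rfl
    have hodd : Odd (s * m.natAbs) := by
      rw [← natAbs_natCast_mul]; exact Int.natAbs_odd.2 hsm
    rw [hχb, chi2Value, if_neg (by omega), if_pos h4, kroneckerSymbol_eq habs hodd, hχ8,
      jacobiSym.neg _ hodd, e]
    have hsgn : (if a < 0 ∧ -ρ < 0 then (-1 : ℤ) else 1) * ZMod.χ₄ ((s * m.natAbs : ℕ) : ZMod 4)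
        = if ((s : ℤ) * m) % 4 = 1 then 1 else -1 := by
      have hsm_neg : a < 0 ↔ (s : ℤ) * m < 0 := by
        rw [hab2]
        exact ⟨fun h => neg_of_mul_neg_right h (by positivity),
          fun h => mul_neg_of_pos_of_neg (by positivity) h⟩
      simp only [← natAbs_natCast_mul, hsm_neg]
      rw [ZMod.χ₄_nat_eq_if_mod_four]
      split_ifs <;> first | rfl | omega
    have hmb : (s : ℤ) * m * b = 8 * (j * (m * b₁)) + m * b₁ := by
      rw [hb]; linear_combination m * b₁ * hj
    have h3 : ((s : ℤ) * m * b) % 4 = (((s : ℤ) * m) % 4) * 3 % 4 := by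
      rw [Int.mul_emod, hb4]
    have hiff : (if P % 4 = 3 ∧ (m * b₁) % 4 = 1 then (-1 : ℤ) else 1)
        = if ((s : ℤ) * m) % 4 = 1 then 1 else -1 := by
      split_ifs <;> omega
    rw [hiff, h2P] at key
    have hpp : ((-1 : ℤ) ^ k) * (-1) ^ k = 1 := by rw [← mul_pow]; norm_num
    have hεε : (if ((s : ℤ) * m) % 4 = 1 then (1 : ℤ) else -1)
        * (if ((s : ℤ) * m) % 4 = 1 then (1 : ℤ) else -1) = 1 := by
      split_ifs <;> norm_num
    generalize (if ((s : ℤ) * m) % 4 = 1 then (1 : ℤ) else -1) = ε at *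
    generalize (if a < 0 ∧ -ρ < 0 then (-1 : ℤ) else 1) = σ at *
    linear_combination -(-1) ^ k * J(q | s) * J(q | s) * J(P | m.natAbs) * J(P | b₁.natAbs) * hsgn
      - (-1) ^ k * J(q | s) * J(q | s) * ε * key
      - J(q | s) * J(q | s) * ε * ε * hpp - J(q | s) * J(q | s) * hεε - hqq

/-- A line in an octuple forces a circle of curvature `1` modulo `4`: the curvatures of the three
neighbours of the line are squares. -/
theorem exists_mod_four_eq_one {b d e : ℤ} (hb : 0 ≤ b) (hd : 0 ≤ d)
    (h : (b + d + e) ^ 2 = 2 * (b ^ 2 + d ^ 2 + e ^ 2))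
    (hprim : ∀ l : ℤ, l ∣ b → l ∣ d → l ∣ e → IsUnit l) : b % 4 = 1 ∨ d % 4 = 1 := by
  have hev : Even (b + d - e) := by
    have h1 : Even ((b + d + e) ^ 2) := by rw [h]; exact even_two_mul _
    have h2 := (Int.even_pow.1 h1).1
    rw [show b + d - e = b + d + e - 2 * e by ring]
    exact h2.sub (even_two_mul _)
  obtain ⟨T, hT⟩ := hev
  have hbd : b * d = T ^ 2 := by
    have : (b + d - e) ^ 2 = 4 * (b * d) := by linear_combination -h
    rw [hT] at this
    linarith [this, show (T + T) ^ 2 = 4 * T ^ 2 by ring]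
  have hco : IsCoprime b d := isCoprime_of_forall_prime fun l hl h1 h2 => by
    have h3 : l ∣ T := hl.dvd_of_dvd_pow (hbd ▸ dvd_mul_of_dvd_left h1 d)
    refine hl.not_isUnit (hprim l h1 h2 ?_)
    rw [show e = b + d - (T + T) by linarith]
    exact dvd_sub (dvd_add h1 h2) (dvd_add h3 h3)
  have hsq : ∀ u v : ℤ, 0 ≤ u → IsCoprime u v → u * v = T ^ 2 → ∃ w, u = w ^ 2 := by
    intro u v hu huv he
    obtain ⟨w, hw | hw⟩ := Int.sq_of_isCoprime huv he
    · exact ⟨w, hw⟩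
    · exact ⟨0, by nlinarith [sq_nonneg w]⟩
  obtain ⟨u, hu⟩ := hsq b d hb hco hbd
  obtain ⟨w, hw⟩ := hsq d b hd hco.symm (by rw [mul_comm]; exact hbd)
  rcases Int.even_or_odd u with h1 | h1
  · rcases Int.even_or_odd w with h2 | h2
    · have h3 : (2 : ℤ) ∣ b := by rw [hu]; exact dvd_pow h1.two_dvd two_ne_zero
      have h4 : (2 : ℤ) ∣ d := by rw [hw]; exact dvd_pow h2.two_dvd two_ne_zero
      exact absurd (hco.isUnit_of_dvd' h3 h4) (by decide)
    · right; rw [hw]; exact Int.sq_mod_four_eq_one_of_odd h2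
  · left; rw [hu]; exact Int.sq_mod_four_eq_one_of_odd h1

/-! ### The invariant on the packing -/

theorem form_nonneg {a p β q : ℤ} (ha : a ≠ 0) (hp : 0 ≤ p) (hpq : p * q = β ^ 2 + 2 * a ^ 2)
    (x y : ℤ) : 0 ≤ p * x ^ 2 - 2 * β * x * y + q * y ^ 2 := by
  have hT : p * (p * x ^ 2 - 2 * β * x * y + q * y ^ 2) = (p * x - β * y) ^ 2
      + 2 * a ^ 2 * y ^ 2 := by
    linear_combination y ^ 2 * hpq
  have hp' : 0 < p := lt_of_le_of_ne hp fun h => by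
    rw [← h] at hpq
    have : 0 < a ^ 2 := by positivity
    nlinarith [sq_nonneg β]
  exact nonneg_of_mul_nonneg_right (hT ▸ by positivity) hp'

theorem form_pos {a p β q : ℤ} (ha : a ≠ 0) (hp : 0 ≤ p) (hpq : p * q = β ^ 2 + 2 * a ^ 2)
    {x y : ℤ} (hxy : IsCoprime x y) : 0 < p * x ^ 2 - 2 * β * x * y + q * y ^ 2 := by
  refine lt_of_le_of_ne (form_nonneg ha hp hpq x y) fun h0 => ?_
  have ha2 : 0 < a ^ 2 := by positivity
  have hp' : p ≠ 0 := fun h => by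
    rw [h] at hpq
    nlinarith [sq_nonneg β]
  have hT : p * (p * x ^ 2 - 2 * β * x * y + q * y ^ 2) = (p * x - β * y) ^ 2
      + 2 * (a * y) ^ 2 := by
    linear_combination y ^ 2 * hpq
  rw [← h0, mul_zero] at hT
  have h1 : (a * y) ^ 2 = 0 := by
    nlinarith [sq_nonneg (p * x - β * y), sq_nonneg (a * y)]
  have hy : y = 0 := by
    simpa [ha] using h1
  have hx : x = 0 := by
    rw [hy] at h0
    simpa [hp'] using h0.symm
  rw [hx, hy] at hxy
  exact not_isCoprime_zero_zero hxy

theorem exists_half_middle_coeff {a p q r : ℤ}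
    (h : (p + q + r) ^ 2 - 2 * (p ^ 2 + q ^ 2 + r ^ 2) = 8 * a ^ 2) :
    ∃ β, 2 * β = p + q - r ∧ p * q = β ^ 2 + 2 * a ^ 2 := by
  have h1 : Even ((p + q + r) ^ 2) :=
    ⟨(p ^ 2 + q ^ 2 + r ^ 2) + 4 * a ^ 2, by linarith⟩
  obtain ⟨t, ht⟩ := (Int.even_pow.1 h1).1
  have hβ : 2 * (t - r) = p + q - r := by linarith
  refine ⟨t - r, hβ, ?_⟩
  have : (2 * (t - r)) ^ 2 = (p + q - r) ^ 2 := by rw [hβ]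
  linarith [show (p + q + r) ^ 2 - 2 * (p ^ 2 + q ^ 2 + r ^ 2) + (p + q - r) ^ 2 = 4 * (p * q) by
    ring, show (2 * (t - r)) ^ 2 = 4 * (t - r) ^ 2 by ring]

theorem zsmul_inversive_apply (n : ℤ) (x : InversiveSpace) (k : Fin 4) :
    (n • x) k = n * x k := by
  rw [Pi.smul_apply, zsmul_eq_mul]

theorem Fin.exists_third {i j : Fin 3} (h : i ≠ j) : ∃ l, i ≠ l ∧ j ≠ l := by
  revert i j; decide

theorem Fin.sum_three_of_ne {M : Type*} [AddCommMonoid M] {i j l : Fin 3} (hij : i ≠ j)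
    (hil : i ≠ l) (hjl : j ≠ l) (f : Fin 3 → M) : ∑ k, f k = f i + f j + f l := by
  have : (Finset.univ : Finset (Fin 3)) = {i, j, l} := by
    revert i j l; decide
  rw [this, Finset.sum_insert (by simp [hij, hil]), Finset.sum_insert (by simp [hjl]),
    Finset.sum_singleton, add_assoc]

theorem forall_of_three {p : Fin 3 → Prop} {i j l : Fin 3} (hij : i ≠ j) (hil : i ≠ l)
    (hjl : j ≠ l) (hi : p i) (hj : p j) (hl : p l) (k : Fin 3) : p k := by
  have aux : ∀ i j l k : Fin 3, i ≠ j → i ≠ l → j ≠ l → k = i ∨ k = j ∨ k = l := by decide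
  rcases aux i j l k hij hil hjl with rfl | rfl | rfl <;> assumption

theorem kroneckerSymbol_two_pow_mul_sq {a n : ℤ} (j : ℕ) (hn : n ≠ 0) (hco : IsCoprime a n)
    (ha : Odd a) : kroneckerSymbol a (2 ^ j * n ^ 2) = ZMod.χ₈ (a : ZMod 8) ^ j := by
  obtain ⟨m, hk, hm⟩ := FiniteMultiplicity.exists_eq_pow_mul_and_not_dvd
    (Int.finiteMultiplicity_iff.2 ⟨by decide, hn⟩ : FiniteMultiplicity 2 n)
  generalize multiplicity 2 n = k at hk
  have hmo : Odd m := by rwa [← Int.not_even_iff_odd, even_iff_two_dvd]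
  have habs : (2 ^ j * n ^ 2).natAbs = 2 ^ (j + 2 * k) * m.natAbs ^ 2 := by
    rw [hk, Int.natAbs_mul, Int.natAbs_pow, Int.natAbs_pow, Int.natAbs_mul, Int.natAbs_pow]
    change 2 ^ j * (2 ^ k * m.natAbs) ^ 2 = _
    ring
  have hcm : IsCoprime a (m.natAbs : ℤ) :=
    (hk ▸ hco).of_mul_right_right.of_isCoprime_of_dvd_right (Int.natAbs_dvd.2 dvd_rfl)
  have hχ : ZMod.χ₈ (a : ZMod 8) ^ 2 = 1 := by
    rw [ZMod.χ₈_int_eq_if_mod_eight, if_neg (by have := Int.odd_iff.1 ha; omega)]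
    split_ifs <;> norm_num
  rw [kroneckerSymbol_eq habs ((Int.natAbs_odd.2 hmo).pow),
    if_neg (fun h => absurd h.1 (not_lt.2 (by positivity))), jacobiSym.pow_right,
    jacobiSym.sq_one (gcd_eq_one_of_isCoprime_natCast hcm), pow_add, pow_mul, hχ]
  simp

namespace CubicConfiguration

open IsCubeFrame

variable {B : CubicConfiguration} {o : CubeVertex → GenCircle} {c : CubeVertex → ℤ}

theorem IsOctuple.mem_packing (ho : B.IsOctuple o) (v : CubeVertex) : o v ∈ B.packing :=
  ⟨o, ho, v, rfl⟩

theorem Integral.exists_curv (h : B.Integral) (ho : B.IsOctuple o) :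
    ∃ c : CubeVertex → ℤ, ∀ v, (o v).curv = c v := by
  choose c hc using fun v => h _ (ho.mem_packing v)
  exact ⟨c, hc⟩

theorem IsOctuple.curv_sum_nonneg (ho : B.IsOctuple o) (hc : ∀ v, (o v).curv = c v)
    (v : CubeVertex) (k : Fin 3) : 0 ≤ c v + c (v.flip k) := by
  obtain ⟨Λ, hΛ⟩ := B.exists_octuple_frame
  obtain ⟨P, W, h, hP, -, hv⟩ := hΛ o ho
  have := h.nullVec_curv_nonneg hP v k
  rw [nullVec, ← hv, ← hv, Pi.add_apply, GenCircle.vec_curv, GenCircle.vec_curv, hc, hc] at this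
  exact_mod_cast this

theorem IsOctuple.curv_quadratic (ho : B.IsOctuple o) (hc : ∀ v, (o v).curv = c v)
    (v : CubeVertex) : (∑ k, (c v + c (v.flip k))) ^ 2 - 2 * ∑ k, (c v + c (v.flip k)) ^ 2
      = 8 * c v ^ 2 := by
  obtain ⟨Λ, hΛ⟩ := B.exists_octuple_frame
  obtain ⟨P, W, h, hP, -, hv⟩ := hΛ o ho
  have := h.curv_quadratic v
  simp only [nullVec, ← hv, Pi.add_apply, GenCircle.vec_curv, hc] at this
  exact_mod_cast this

theorem IsOctuple.curv_flip_flip (ho : B.IsOctuple o) (hc : ∀ v, (o v).curv = c v)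
    (v : CubeVertex) {i j : Fin 3} (hij : i ≠ j) :
    c ((v.flip i).flip j) = c (v.flip i) + c (v.flip j) - c v := by
  obtain ⟨Λ, hΛ⟩ := B.exists_octuple_frame
  obtain ⟨P, W, h, hP, -, hv⟩ := hΛ o ho
  have hr : ∀ u, (c u : ℝ) = vertex P W u 1 := fun u => by
    rw [← hc, ← GenCircle.vec_curv, hv]
  have : (c ((v.flip i).flip j) : ℝ) = c (v.flip i) + c (v.flip j) - c v := by
    simp only [hr, vertex_flip, Pi.sub_apply, Pi.smul_apply, flip_apply, if_neg hij.symm]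
    ring
  exact_mod_cast this

theorem flip_flip (v : CubeVertex) (k : Fin 3) : (v.flip k).flip k = v := by
  funext i
  simp only [flip_apply]
  split_ifs <;> simp

theorem flip_comm (v : CubeVertex) (i j : Fin 3) : (v.flip i).flip j = (v.flip j).flip i := by
  funext k
  simp only [flip_apply]
  split_ifs <;> rfl

/-- All curvatures of the packing are integral combinations of those of a circle and its three
neighbours, because the lattice generated by an octuple does not depend on the octuple. -/
theorem Primitive.isUnit_of_dvd (hB : B.Primitive) (ho : B.IsOctuple o)
    (hc : ∀ v, (o v).curv = c v) (v : CubeVertex) {d : ℤ} (hd : d ∣ c v)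
    (hdk : ∀ k, d ∣ c (v.flip k)) : IsUnit d := by
  obtain ⟨Λ, hΛ⟩ := B.exists_octuple_frame
  obtain ⟨P, W, h, hP, hL, hv⟩ := hΛ o ho
  refine hB.2 d ?_
  rintro _ ⟨o', ho', w, rfl⟩
  obtain ⟨P', W', h', hP', hL', hv'⟩ := hΛ o' ho'
  have hm : (o' w).vec ∈ lattice P W := by
    rw [hL, ← hL', hv']; exact vertex_mem_lattice w
  obtain ⟨m, n, hx⟩ := exists_coeff_of_mem_lattice v hm
  have h1 : (o' w).curv = ((m * c v + ∑ k, n k * (c v + c (v.flip k)) : ℤ) : ℝ) := by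
    have := congrFun hx 1
    simp only [nullVec, ← hv, Pi.add_apply, Finset.sum_apply, zsmul_inversive_apply,
      GenCircle.vec_curv, hc] at this
    rw [this]
    push_cast
    rfl
  obtain ⟨e, he⟩ : d ∣ m * c v + ∑ k, n k * (c v + c (v.flip k)) :=
    dvd_add (dvd_mul_of_dvd_right hd _)
      (Finset.dvd_sum fun k _ => dvd_mul_of_dvd_right (dvd_add hd (hdk k)) _)
  exact ⟨e, by rw [h1, he]⟩

theorem IsType023.mod_four_ne_one (hB : B.IsType023) (ho : B.IsOctuple o)
    (hc : ∀ v, (o v).curv = c v) (v : CubeVertex) : c v % 4 ≠ 1 := by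
  intro h
  have h1 : ((c v : ℤ) : ZMod 4) ∈ ({0, 2, 3} : Set (ZMod 4)) := by
    rw [← hB]; exact ⟨o v, ho.mem_packing v, c v, hc v, rfl⟩
  have h2 : ((c v : ℤ) : ZMod 4) = 1 := by
    have := (ZMod.intCast_eq_intCast_iff (c v) 1 4).2 h
    simpa using this
  rw [h2] at h1
  revert h1
  decide

theorem curv_ne_zero (hB : B.Primitive) (hB' : B.IsType023) (ho : B.IsOctuple o)
    (hc : ∀ v, (o v).curv = c v) (v : CubeVertex) : c v ≠ 0 := by
  intro h0
  have hs := ho.curv_sum_nonneg hc v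
  have hq := ho.curv_quadratic hc v
  simp only [h0, zero_add, Fin.sum_univ_three] at hs hq
  have := exists_mod_four_eq_one (hs 0) (hs 1)
    (show (c (v.flip 0) + c (v.flip 1) + c (v.flip 2)) ^ 2 = _ by linarith)
    (fun l h1 h2 h3 => hB.isUnit_of_dvd ho hc v (h0 ▸ dvd_zero l)
      (forall_of_three (i := 0) (j := 1) (l := 2) (by decide) (by decide) (by decide) h1 h2 h3))
  rcases this with h | h
  · exact hB'.mod_four_ne_one ho hc _ h
  · exact hB'.mod_four_ne_one ho hc _ h

theorem IsOctuple.exists_middle (ho : B.IsOctuple o) (hc : ∀ v, (o v).curv = c v)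
    (v : CubeVertex) {i j l : Fin 3} (hij : i ≠ j) (hil : i ≠ l) (hjl : j ≠ l) :
    ∃ β, 2 * β = (c v + c (v.flip i)) + (c v + c (v.flip j)) - (c v + c (v.flip l)) ∧
      (c v + c (v.flip i)) * (c v + c (v.flip j)) = β ^ 2 + 2 * c v ^ 2 := by
  have h := ho.curv_quadratic hc v
  rw [Fin.sum_three_of_ne hij hil hjl, Fin.sum_three_of_ne hij hil hjl] at h
  exact exists_half_middle_coeff h

/-- At a vertex of even curvature with a neighbour of even curvature the other two neighbours have
odd curvature. -/
theorem odd_of_even_even (hB : B.Primitive) (ho : B.IsOctuple o)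
    (hc : ∀ v, (o v).curv = c v) (v : CubeVertex) {i j : Fin 3} (hij : i ≠ j)
    (hv : Even (c v)) (hi : Even (c (v.flip i))) : Odd (c (v.flip j)) := by
  obtain ⟨l, hil, hjl⟩ := Fin.exists_third hij
  obtain ⟨β, hβ, -⟩ := ho.exists_middle hc v hij hil hjl
  rw [← Int.not_even_iff_odd]
  intro hj
  have hl : Even (c (v.flip l)) := by
    rw [Int.even_iff] at *; omega
  have := hB.isUnit_of_dvd ho hc v hv.two_dvd
    (forall_of_three hij hil hjl hi.two_dvd hj.two_dvd hl.two_dvd)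
  exact absurd this (by decide)

theorem adjacentForms (hB : B.Primitive) (hB' : B.IsType023) (ho : B.IsOctuple o)
    (hc : ∀ v, (o v).curv = c v) (v : CubeVertex) {i j l : Fin 3} (hij : i ≠ j) (hil : i ≠ l)
    (hjl : j ≠ l) {β : ℤ}
    (hβ : 2 * β = (c v + c (v.flip i)) + (c v + c (v.flip j)) - (c v + c (v.flip l)))
    (hpq : (c v + c (v.flip i)) * (c v + c (v.flip j)) = β ^ 2 + 2 * c v ^ 2) :
    AdjacentForms (c v) (c (v.flip i)) (c v + c (v.flip i)) β (c v + c (v.flip j)) where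
  sum_eq := rfl
  sum_pos := by
    refine lt_of_le_of_ne (ho.curv_sum_nonneg hc v i) fun h => ?_
    rw [← h] at hpq
    have : 0 < c v ^ 2 := by have := curv_ne_zero hB hB' ho hc v; positivity
    nlinarith [sq_nonneg β]
  left_ne := curv_ne_zero hB hB' ho hc v
  disc_eq := hpq
  primitive := by
    intro m hm h1 h2 h3
    have h4 : m ∣ β := by
      refine hm.dvd_of_dvd_pow (n := 2) ?_
      rw [show β ^ 2 = (c v + c (v.flip i)) * (c v + c (v.flip j)) - 2 * c v ^ 2 by linarith]
      exact dvd_sub (dvd_mul_of_dvd_left h2 _) (dvd_mul_of_dvd_right (dvd_pow h1 two_ne_zero) _)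
    have h5 : m ∣ c v + c (v.flip l) := by
      rw [show c v + c (v.flip l) = (c v + c (v.flip i)) + (c v + c (v.flip j)) - 2 * β by linarith]
      exact dvd_sub (dvd_add h2 h3) (dvd_mul_of_dvd_right h4 _)
    exact hm.not_isUnit (hB.isUnit_of_dvd ho hc v h1 (forall_of_three hij hil hjl
      ((dvd_add_right h1).1 h2) ((dvd_add_right h1).1 h3) ((dvd_add_right h1).1 h5)))

theorem cubicForm_intCast {a b d e β : ℤ} (hβ : 2 * β = (a + b) + (a + d) - (a + e)) (x y : ℤ) :
    cubicForm a b d e x y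
      = (((a + b) * x ^ 2 - 2 * β * x * y + (a + d) * y ^ 2 : ℤ) : ℝ) := by
  rw [hβ, cubicForm]
  push_cast
  ring

/-- A number represented by the form of some octuple containing a circle is represented by the form
of any other such octuple, with the neighbours in any order: the represented numbers are the
curvatures of the primitive future null vectors of the lattice that are orthogonal to the
circle. -/
theorem Represents.exists_eq (hB : B.Primitive) (hB' : B.IsType023) (ho : B.IsOctuple o)
    (hc : ∀ v, (o v).curv = c v) {v : CubeVertex} {ρ : ℤ} (hρ : B.Represents (o v) ρ)
    {i j l : Fin 3} (hij : i ≠ j) (hil : i ≠ l) (hjl : j ≠ l) {β : ℤ}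
    (hβ : 2 * β = (c v + c (v.flip i)) + (c v + c (v.flip j)) - (c v + c (v.flip l)))
    (hpq : (c v + c (v.flip i)) * (c v + c (v.flip j)) = β ^ 2 + 2 * c v ^ 2) :
    0 < ρ ∧ ∃ x y, ρ = (c v + c (v.flip i)) * x ^ 2 - 2 * β * x * y
      + (c v + c (v.flip j)) * y ^ 2 := by
  obtain ⟨o', ho', v', hv, x, y, -, hxy, hρ⟩ := hρ
  obtain ⟨c', hc'⟩ := hB.1.exists_curv ho'
  obtain ⟨β', hβ', hpq'⟩ := ho'.exists_middle hc' v' (i := 0) (j := 1) (l := 2) (by decide)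
    (by decide) (by decide)
  rw [hv, hc', hc', hc', hc', cubicForm_intCast hβ', Int.cast_inj] at hρ
  have hpos : 0 < ρ := hρ ▸ form_pos (curv_ne_zero hB hB' ho' hc' v')
    (ho'.curv_sum_nonneg hc' v' 0) hpq' hxy
  refine ⟨hpos, ?_⟩
  obtain ⟨Λ, hΛ⟩ := B.exists_octuple_frame
  obtain ⟨P, W, h, -, hL, hPv⟩ := hΛ o ho
  obtain ⟨P', W', h', -, hL', hPv'⟩ := hΛ o' ho'
  obtain ⟨n, hn, hprim, hsum⟩ := h.exists_primitive_coeff h' (hL.trans hL'.symm)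
    (v := v) (v' := v') (by rw [← hPv, ← hPv', hv])
    (n' := ![x ^ 2 - x * y, y ^ 2 - x * y, x * y])
    (by simp only [Matrix.cons_val_zero, Matrix.cons_val_one, Matrix.cons_val]; ring)
    (by
      intro d hd
      have h0 : d ∣ x ^ 2 - x * y := hd 0
      have h1 : d ∣ y ^ 2 - x * y := hd 1
      have h2 : d ∣ x * y := hd 2
      exact (hxy.pow (m := 2) (n := 2)).isUnit_of_dvd' ((dvd_sub_left h2).1 h0)
        ((dvd_sub_left h2).1 h1))
  have hconic : n i * n j + n i * n l + n j * n l = 0 := by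
    have e1 := Fin.sum_three_of_ne hij hil hjl n
    have e2 := Fin.sum_three_of_ne hij hil hjl fun k => n k ^ 2
    rw [Fin.sum_univ_three] at e1 e2
    have : (n 0 + n 1 + n 2) ^ 2 = (n i + n j + n l) ^ 2 := by rw [e1]
    linarith [show (n 0 + n 1 + n 2) ^ 2 = n 0 ^ 2 + n 1 ^ 2 + n 2 ^ 2
        + 2 * (n 0 * n 1 + n 0 * n 2 + n 1 * n 2) by ring,
      show (n i + n j + n l) ^ 2 = n i ^ 2 + n j ^ 2 + n l ^ 2
        + 2 * (n i * n j + n i * n l + n j * n l) by ring]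
  obtain ⟨s, t, ε, hε, e0, e1, e2⟩ := exists_param_of_conic hconic
    fun d h0 h1 h2 => hprim d (forall_of_three hij hil hjl h0 h1 h2)
  have hcurv : n i * (c v + c (v.flip i)) + n j * (c v + c (v.flip j))
      + n l * (c v + c (v.flip l)) = ρ := by
    have := congrFun hsum 1
    rw [Fin.sum_three_of_ne hij hil hjl, Fin.sum_univ_three] at this
    simp only [nullVec, ← hPv, ← hPv', Pi.add_apply, zsmul_inversive_apply, GenCircle.vec_curv,
      hc, hc', Matrix.cons_val_zero, Matrix.cons_val_one, Matrix.cons_val] at this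
    have h2 : n i * (c v + c (v.flip i)) + n j * (c v + c (v.flip j))
        + n l * (c v + c (v.flip l)) = (x ^ 2 - x * y) * (c' v' + c' (v'.flip 0))
        + (y ^ 2 - x * y) * (c' v' + c' (v'.flip 1)) + x * y * (c' v' + c' (v'.flip 2)) := by
      exact_mod_cast this
    rw [h2, hρ, hβ']
    ring
  have hval : ρ = ε * ((c v + c (v.flip i)) * s ^ 2 - 2 * β * s * t
      + (c v + c (v.flip j)) * t ^ 2) := by
    rw [← hcurv, e0, e1, e2, hβ]
    ring
  have hnn := form_nonneg (curv_ne_zero hB hB' ho hc v) (ho.curv_sum_nonneg hc v i) hpq s t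
  rcases hε with rfl | rfl
  · exact ⟨s, t, by rw [hval, one_mul]⟩
  · linarith

theorem exists_admissible (hB : B.Primitive) (hB' : B.IsType023) (ho : B.IsOctuple o)
    (hc : ∀ v, (o v).curv = c v) (v : CubeVertex) : ∃ ρ, B.Admissible (o v) (c v) ρ := by
  have d01 : (0 : Fin 3) ≠ 1 := by decide
  have d02 : (0 : Fin 3) ≠ 2 := by decide
  have d12 : (1 : Fin 3) ≠ 2 := by decide
  obtain ⟨β, hβ, hpq⟩ := ho.exists_middle hc v d01 d02 d12
  obtain ⟨x, y, hy, hxy, hco⟩ := exists_represented_coprime (β := β) (curv_ne_zero hB hB' ho hc v)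
    (adjacentForms hB hB' ho hc v d01 d02 d12 hβ hpq).primitive
  refine ⟨_, hc v, curv_ne_zero hB hB' ho hc v, hco, o, ho, v, rfl, x, y, hy, hxy, ?_⟩
  rw [hc, hc, hc, hc, cubicForm_intCast hβ]

theorem Admissible.curv_eq {C : GenCircle} {a b ρ : ℤ} (h : B.Admissible C a ρ)
    (hb : C.curv = b) : a = b := by
  have := h.1.symm.trans hb
  exact_mod_cast this

theorem chi2Value_mul_of_odd (hB : B.Primitive) (hB' : B.IsType023) (ho : B.IsOctuple o)
    (hc : ∀ v, (o v).curv = c v) (v : CubeVertex) (i : Fin 3) (hi : Odd (c (v.flip i)))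
    {ρ ρ' : ℤ} (hρ : B.Admissible (o v) (c v) ρ)
    (hρ' : B.Admissible (o (v.flip i)) (c (v.flip i)) ρ') :
    chi2Value (c v) ρ * chi2Value (c (v.flip i)) ρ' = -1 := by
  obtain ⟨j, hij⟩ : ∃ j : Fin 3, i ≠ j := (exists_ne i).imp fun _ h => h.symm
  obtain ⟨l, hil, hjl⟩ := Fin.exists_third hij
  obtain ⟨β, hβ, hpq⟩ := ho.exists_middle hc v hij hil hjl
  have hA := adjacentForms hB hB' ho hc v hij hil hjl hβ hpq
  have hj := ho.curv_flip_flip hc v hij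
  have hl := ho.curv_flip_flip hc v hil
  -- the form of the neighbour has the same first and middle coefficients
  obtain ⟨β', hβ', hpq'⟩ := ho.exists_middle hc (v.flip i) hij hil hjl
  have hββ : β' = β := by
    rw [flip_flip, hj, hl] at hβ'
    linarith
  subst hββ
  obtain ⟨hpos, x, y, hx⟩ := hρ.2.2.2.exists_eq hB hB' ho hc hij hil hjl hβ hpq
  obtain ⟨hpos', x', y', hx'⟩ := hρ'.2.2.2.exists_eq hB hB' ho hc hij hil hjl hβ' hpq'
  have h1 := hB'.mod_four_ne_one ho hc (v.flip i)
  refine hA.chi2Value_mul (x' := x') (y' := y') (by have := Int.odd_iff.1 hi; omega)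
    (hB'.mod_four_ne_one ho hc v) rfl hx ?_ hpos hpos' hρ.2.2.1 hρ'.2.2.1
  rw [hx', flip_flip, hj]
  ring

theorem chi2Value_mul_of_odd_or_odd (hB : B.Primitive) (hB' : B.IsType023) (ho : B.IsOctuple o)
    (hc : ∀ v, (o v).curv = c v) (v : CubeVertex) (i : Fin 3)
    (hi : Odd (c v) ∨ Odd (c (v.flip i)))
    {ρ ρ' : ℤ} (hρ : B.Admissible (o v) (c v) ρ)
    (hρ' : B.Admissible (o (v.flip i)) (c (v.flip i)) ρ') :
    chi2Value (c v) ρ * chi2Value (c (v.flip i)) ρ' = -1 := by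
  rcases hi with h | h
  · have := chi2Value_mul_of_odd hB hB' ho hc (v.flip i) i (by rwa [flip_flip]) hρ'
      (by rw [flip_flip]; exact hρ)
    rwa [flip_flip, mul_comm] at this
  · exact chi2Value_mul_of_odd hB hB' ho hc v i h hρ hρ'

theorem exists_odd_neighbour (hB : B.Primitive) (ho : B.IsOctuple o)
    (hc : ∀ v, (o v).curv = c v) (v : CubeVertex) (hv : Even (c v)) :
    ∃ i, Odd (c (v.flip i)) := by
  rcases Int.even_or_odd (c (v.flip 0)) with h | h
  · exact ⟨1, odd_of_even_even hB ho hc v (by decide) hv h⟩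
  · exact ⟨0, h⟩

/-- The value of `χ₂` is independent of `ρ` because its product with the value at a neighbour
is. -/
theorem chi2Value_eq_chi2 (hB : B.Primitive) (hB' : B.IsType023) {C : GenCircle}
    (hC : C ∈ B.packing) {a ρ : ℤ} (h : B.Admissible C a ρ) : chi2Value a ρ = B.chi2 C := by
  obtain ⟨o, ho, v, rfl⟩ := hC
  obtain ⟨c, hc⟩ := hB.1.exists_curv ho
  have hex : ∃ p : ℤ × ℤ, B.Admissible (o v) p.1 p.2 := ⟨(a, ρ), h⟩
  rw [chi2, dif_pos hex]
  have h' := Classical.choose_spec hex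
  generalize Classical.choose hex = q at h'
  obtain ⟨a', ρ'⟩ := q
  obtain rfl := h.curv_eq (hc v)
  obtain rfl : a' = c v := h'.curv_eq (hc v)
  obtain ⟨i, hi⟩ : ∃ i, Odd (c v) ∨ Odd (c (v.flip i)) := by
    rcases Int.even_or_odd (c v) with h0 | h0
    · obtain ⟨i, hi⟩ := exists_odd_neighbour hB ho hc v h0
      exact ⟨i, Or.inr hi⟩
    · exact ⟨0, Or.inl h0⟩
  obtain ⟨τ, hτ⟩ := exists_admissible hB hB' ho hc (v.flip i)
  have e1 := chi2Value_mul_of_odd_or_odd hB hB' ho hc v i hi h hτ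
  have e2 := chi2Value_mul_of_odd_or_odd hB hB' ho hc v i hi h' hτ
  have hne : chi2Value (c (v.flip i)) τ ≠ 0 := by
    intro h0; rw [h0, mul_zero] at e1; norm_num at e1
  exact mul_right_cancel₀ hne (e1.trans e2.symm)

theorem chi2_flip_of_odd (hB : B.Primitive) (hB' : B.IsType023) (ho : B.IsOctuple o)
    (hc : ∀ v, (o v).curv = c v) (v : CubeVertex) (i : Fin 3)
    (hi : Odd (c v) ∨ Odd (c (v.flip i))) :
    (B.chi2 (o v) = 1 ∨ B.chi2 (o v) = -1) ∧ B.chi2 (o (v.flip i)) = -B.chi2 (o v) := by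
  obtain ⟨ρ, hρ⟩ := exists_admissible hB hB' ho hc v
  obtain ⟨τ, hτ⟩ := exists_admissible hB hB' ho hc (v.flip i)
  have e := chi2Value_mul_of_odd_or_odd hB hB' ho hc v i hi hρ hτ
  rw [chi2Value_eq_chi2 hB hB' (ho.mem_packing _) hρ,
    chi2Value_eq_chi2 hB hB' (ho.mem_packing _) hτ] at e
  have h1 := Int.eq_one_or_neg_one_of_mul_eq_neg_one e
  refine ⟨h1, ?_⟩
  rcases h1 with h1 | h1 <;> rw [h1] at e ⊢ <;> linarith

/-- Along an edge with two even curvatures, `χ₂` is compared along the other three edges of a face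
that contains the edge. -/
theorem chi2_flip (hB : B.Primitive) (hB' : B.IsType023) (ho : B.IsOctuple o)
    (v : CubeVertex) (i : Fin 3) :
    (B.chi2 (o v) = 1 ∨ B.chi2 (o v) = -1) ∧ B.chi2 (o (v.flip i)) = -B.chi2 (o v) := by
  obtain ⟨c, hc⟩ := hB.1.exists_curv ho
  by_cases hi : Odd (c v) ∨ Odd (c (v.flip i))
  · exact chi2_flip_of_odd hB hB' ho hc v i hi
  · rw [not_or, Int.not_odd_iff_even, Int.not_odd_iff_even] at hi
    obtain ⟨hv, hi⟩ := hi
    obtain ⟨j, hij⟩ : ∃ j : Fin 3, i ≠ j := (exists_ne i).imp fun _ h => h.symm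
    have h1 := odd_of_even_even hB ho hc v hij hv hi
    have h2 := odd_of_even_even hB ho hc (v.flip i) hij hi (by rwa [flip_flip])
    obtain ⟨e0, e1⟩ := chi2_flip_of_odd hB hB' ho hc v j (Or.inr h1)
    have e2 := (chi2_flip_of_odd hB hB' ho hc (v.flip j) i (Or.inl h1)).2
    have e3 := (chi2_flip_of_odd hB hB' ho hc (v.flip i) j (Or.inr h2)).2
    rw [flip_comm] at e3
    refine ⟨e0, ?_⟩
    linarith

theorem IsOctuple.tangent_flip (hB : B.Primitive) (hB' : B.IsType023) (ho : B.IsOctuple o)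
    (v : CubeVertex) (i : Fin 3) : (o v).Tangent (o (v.flip i)) := by
  obtain ⟨c, hc⟩ := hB.1.exists_curv ho
  obtain ⟨j, hij⟩ : ∃ j : Fin 3, i ≠ j := (exists_ne i).imp fun _ h => h.symm
  obtain ⟨l, hil, hjl⟩ := Fin.exists_third hij
  obtain ⟨β, hβ, hpq⟩ := ho.exists_middle hc v hij hil hjl
  obtain ⟨Λ, hΛ⟩ := B.exists_octuple_frame
  obtain ⟨P, W, h, -, -, hv⟩ := hΛ o ho
  refine GenCircle.tangent_of_inner_eq_neg_one ?_ ?_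
  · rw [← GenCircle.lorentz_vec, hv, hv, h.vertex_vertex_flip]
  · rw [hc, hc]
    exact_mod_cast (adjacentForms hB hB' ho hc v hij hil hjl hβ hpq).sum_pos

end CubicConfiguration

/-- The colours as signs. -/
def Colour.sign : Colour → ℤ
  | .blue => 1
  | .red => -1

theorem Colour.sign_of_ne {a b : Colour} (h : a ≠ b) : b.sign = -a.sign := by
  cases a <;> cases b <;> first | rfl | exact absurd rfl h

namespace CubicConfiguration

variable {B : CubicConfiguration}

/-- `χ₂` times the sign of the colour is constant: both change along every edge of an octuple, and
octuples that are reflections of each other in a dual circle share four circles. -/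
theorem exists_chi2_eq_mul_sign (hB : B.Primitive) (hB' : B.IsType023)
    {col : GenCircle → Colour} (hcol : B.IsTwoColouring col) :
    ∃ ε : ℤ, (ε = 1 ∨ ε = -1) ∧ ∀ C ∈ B.packing, B.chi2 C = ε * (col C).sign := by
  have hflip : ∀ o, B.IsOctuple o → ∀ v i, B.chi2 (o (CubeVertex.flip v i)) *
      (col (o (CubeVertex.flip v i))).sign = B.chi2 (o v) * (col (o v)).sign := by
    intro o ho v i
    rw [(chi2_flip hB hB' ho v i).2, Colour.sign_of_ne (hcol _ (ho.mem_packing v) _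
      (ho.mem_packing _) (ho.tangent_flip hB hB' v i))]
    ring
  have hbase : B.IsOctuple B.base := ⟨1, one_mem _, fun v => rfl⟩
  obtain ⟨v₀⟩ : Nonempty CubeVertex := inferInstance
  have hsign : ∀ a : Colour, a.sign * a.sign = 1 := by
    intro a; cases a <;> rfl
  refine ⟨B.chi2 (B.base v₀) * (col (B.base v₀)).sign, ?_, ?_⟩
  · rcases (chi2_flip hB hB' hbase v₀ 0).1 with h | h <;> rw [h] <;>
      cases col (B.base v₀) <;> simp [Colour.sign]
  · rintro _ ⟨o, ho, v, rfl⟩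
    have key := B.octuple_induction (p := fun o => ∀ v, B.chi2 (o v) * (col (o v)).sign
        = B.chi2 (B.base v₀) * (col (B.base v₀)).sign)
      (flip_induction v₀ rfl fun w k hw => by rw [hflip _ hbase, hw])
      (fun o o' _ ho' F hF ih => flip_induction (fun _ => F.2) (by rw [← hF _ rfl, ih])
        fun w k hw => by rw [hflip _ ho', hw]) ho v
    rw [← key, mul_assoc, hsign, mul_one]

end CubicConfiguration


/-! ### The partial obstructions -/

namespace CubicConfiguration

variable {B : CubicConfiguration}

theorem chi2_of_sq (hB : B.Primitive) (hB' : B.IsType023) {C : GenCircle} (hC : C ∈ B.packing)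
    {n : ℤ} (hn : C.curv = (n : ℝ) ^ 2) : B.chi2 C = -1 := by
  obtain ⟨o, ho, v, rfl⟩ := hC
  obtain ⟨c, hc⟩ := hB.1.exists_curv ho
  obtain ⟨ρ, hρ⟩ := exists_admissible hB hB' ho hc v
  have h : c v = n ^ 2 := by rw [hc] at hn; exact_mod_cast hn
  have hne : n ≠ 0 := by
    rintro rfl; exact curv_ne_zero hB hB' ho hc v (by rw [h]; rfl)
  have hev : Even n := by
    rw [← Int.not_odd_iff_even]
    exact fun ho' => hB'.mod_four_ne_one ho hc v (h ▸ Int.sq_mod_four_eq_one_of_odd ho')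
  have h4 : n ^ 2 % 4 = 0 := by
    obtain ⟨m, rfl⟩ := hev
    rw [show (m + m) ^ 2 = 4 * m ^ 2 by ring]; omega
  have hco : IsCoprime ρ n := (IsCoprime.pow_right_iff two_pos).1 (h ▸ hρ.2.2.1)
  have hρo : Odd ρ := by
    rw [← Int.not_even_iff_odd]
    exact fun he => absurd (hco.isUnit_of_dvd' he.two_dvd hev.two_dvd) (by decide)
  have hk := kroneckerSymbol_two_pow_mul_sq 0 hne hco.neg_left hρo.neg
  rw [pow_zero, one_mul, pow_zero] at hk
  rw [← chi2Value_eq_chi2 hB hB' (ho.mem_packing v) hρ, h, chi2Value, if_neg (by omega), if_pos h4,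
    hk]

theorem chi2_of_two_mul_sq (hB : B.Primitive) (hB' : B.IsType023) {C : GenCircle}
    (hC : C ∈ B.packing) {n : ℤ} (hn : C.curv = 2 * (n : ℝ) ^ 2) (hno : Odd n) :
    B.chi2 C = -1 := by
  obtain ⟨o, ho, v, rfl⟩ := hC
  obtain ⟨c, hc⟩ := hB.1.exists_curv ho
  obtain ⟨ρ, hρ⟩ := exists_admissible hB hB' ho hc v
  have h : c v = 2 * n ^ 2 := by rw [hc] at hn; exact_mod_cast hn
  have hne : n ≠ 0 := by rintro rfl; simp at hno
  have h4 := Int.sq_mod_four_eq_one_of_odd hno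
  have hcc : IsCoprime ρ (2 * n ^ 2) := h ▸ hρ.2.2.1
  have hco : IsCoprime ρ n := (IsCoprime.pow_right_iff two_pos).1 hcc.of_mul_right_right
  have hρo : Odd ρ := by
    rw [← Int.not_even_iff_odd]
    exact fun he => absurd (hcc.of_mul_right_left.isUnit_of_dvd' he.two_dvd dvd_rfl) (by decide)
  have hk := kroneckerSymbol_two_pow_mul_sq 0 hne hco hρo
  rw [pow_zero, one_mul, pow_zero] at hk
  rw [← chi2Value_eq_chi2 hB hB' (ho.mem_packing v) hρ, h, chi2Value, if_neg (by omega),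
    if_neg (by omega), if_pos (by omega), Int.mul_ediv_cancel_left _ two_ne_zero, hk]

theorem chi2_of_eight_mul_sq (hB : B.Primitive) (hB' : B.IsType023) {C : GenCircle}
    (hC : C ∈ B.packing) {n : ℤ} (hn : C.curv = 8 * (n : ℝ) ^ 2) : B.chi2 C = 1 := by
  obtain ⟨o, ho, v, rfl⟩ := hC
  obtain ⟨c, hc⟩ := hB.1.exists_curv ho
  obtain ⟨ρ, hρ⟩ := exists_admissible hB hB' ho hc v
  have h : c v = 2 ^ 3 * n ^ 2 := by rw [hc] at hn; exact_mod_cast hn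
  have hne : n ≠ 0 := by
    rintro rfl; exact curv_ne_zero hB hB' ho hc v (by rw [h]; rfl)
  obtain ⟨i, hi⟩ := exists_odd_neighbour hB ho hc v (h ▸ ⟨4 * n ^ 2, by ring⟩)
  obtain ⟨j, hij⟩ : ∃ j : Fin 3, i ≠ j := (exists_ne i).imp fun _ h => h.symm
  obtain ⟨l, hil, hjl⟩ := Fin.exists_third hij
  obtain ⟨β, hβ, hpq⟩ := ho.exists_middle hc v hij hil hjl
  obtain ⟨-, x, y, hx⟩ := hρ.2.2.2.exists_eq hB hB' ho hc hij hil hjl hβ hpq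
  have hi4 := hB'.mod_four_ne_one ho hc (v.flip i)
  have hi2 := Int.odd_iff.1 hi
  have h8 : ρ % 8 = 3 := (adjacentForms hB hB' ho hc v hij hil hjl hβ hpq).mod_eight
    (by omega) (by omega) hx hρ.2.2.1
  have hcc : IsCoprime ρ (2 ^ 3 * n ^ 2) := h ▸ hρ.2.2.1
  have hco : IsCoprime ρ n := (IsCoprime.pow_right_iff two_pos).1 hcc.of_mul_right_right
  have hk := kroneckerSymbol_two_pow_mul_sq 3 hne hco.neg_left
    (Int.odd_iff.2 (by omega))
  rw [ZMod.χ₈_int_eq_if_mod_eight, if_neg (by omega), if_neg (by omega)] at hk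
  rw [← chi2Value_eq_chi2 hB hB' (ho.mem_packing v) hρ, h, chi2Value, if_neg (by omega),
    if_pos (by omega), hk]
  norm_num

end CubicConfiguration

theorem mainTheorem11 (B : CubicConfiguration) (hprim : B.Primitive) (htype : B.IsType023)
    (col : GenCircle → Colour) (hcol : B.IsTwoColouring col) :
    -- `χ₂` is defined at every circle and independent of the choices made
    (∀ C ∈ B.packing, (∃ a ρ : ℤ, B.Admissible C a ρ) ∧
      ∀ a ρ : ℤ, B.Admissible C a ρ → chi2Value a ρ = B.chi2 C) ∧
    -- one value on the blue circles, the opposite value on the red circles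
    (∃ ε : ℤ, (ε = 1 ∨ ε = -1) ∧
      (∀ C ∈ B.packing, col C = Colour.blue → B.chi2 C = ε) ∧
      (∀ C ∈ B.packing, col C = Colour.red → B.chi2 C = -ε)) ∧
    -- the partial obstructions
    ((∀ C ∈ B.packing, col C = Colour.blue → B.chi2 C = 1) →
      (∀ C ∈ B.packing, col C = Colour.blue → ∀ n : ℤ, C.curv ≠ (n : ℝ) ^ 2) ∧
      (∀ C ∈ B.packing, col C = Colour.blue → ∀ n : ℤ, Odd n → C.curv ≠ 2 * (n : ℝ) ^ 2) ∧
      (∀ C ∈ B.packing, col C = Colour.red → ∀ n : ℤ, C.curv ≠ 8 * (n : ℝ) ^ 2)) := by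
  obtain ⟨ε, hε, hchi⟩ := CubicConfiguration.exists_chi2_eq_mul_sign hprim htype hcol
  refine ⟨fun C hC => ⟨?_, fun a ρ h => ?_⟩, ⟨ε, hε, ?_, ?_⟩, fun hblue => ?_⟩
  · obtain ⟨o, ho, v, rfl⟩ := hC
    obtain ⟨c, hc⟩ := hprim.1.exists_curv ho
    obtain ⟨ρ, hρ⟩ := CubicConfiguration.exists_admissible hprim htype ho hc v
    exact ⟨c v, ρ, hρ⟩
  · exact CubicConfiguration.chi2Value_eq_chi2 hprim htype hC h
  · intro C hC h
    rw [hchi C hC, h, Colour.sign, mul_one]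
  · intro C hC h
    rw [hchi C hC, h, Colour.sign, mul_neg_one]
  · -- two adjacent circles of an octuple have different colours, so there is a blue circle
    have hε1 : ε = 1 := by
      have hbase : B.IsOctuple B.base := ⟨1, one_mem _, fun v => rfl⟩
      have hne := hcol _ (hbase.mem_packing fun _ => true) _ (hbase.mem_packing _)
        (hbase.tangent_flip hprim htype (fun _ => true) 0)
      obtain ⟨v, hv⟩ : ∃ v, col (B.base v) = Colour.blue := by
        cases h1 : col (B.base fun _ => true) with
        | blue => exact ⟨_, h1⟩
        | red =>
          cases h2 : col (B.base (CubeVertex.flip (fun _ => true) 0)) with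
          | blue => exact ⟨_, h2⟩
          | red => exact absurd (h1.trans h2.symm) hne
      have h1 := hchi _ (hbase.mem_packing v)
      rw [hblue _ (hbase.mem_packing v) hv, hv, Colour.sign, mul_one] at h1
      exact h1.symm
    refine ⟨fun C hC h n hn => ?_, fun C hC h n ho hn => ?_, fun C hC h n hn => ?_⟩
    · have h1 := hblue C hC h
      rw [CubicConfiguration.chi2_of_sq hprim htype hC hn] at h1
      norm_num at h1
    · have h1 := hblue C hC h
      rw [CubicConfiguration.chi2_of_two_mul_sq hprim htype hC hn ho] at h1
      norm_num at h1
    · have h1 := hchi C hC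
      rw [CubicConfiguration.chi2_of_eight_mul_sq hprim htype hC hn, h, hε1, Colour.sign] at h1
      norm_num at h1
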